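/- Let $k$ be a field, $V$ a finite-dimensional $k$-vector space, $N\ge 2$ an integer, $R$ a subspace of $V^{\otimes N}$, and $A=\mathrm{Tens}(V)/I(R)$ the corresponding $N$-homogeneous algebra, where $I(R)$ is the two-sided ideal generated by $R$; $A$ is graded by the images $A_n$ of $V^{\otimes n}$, and $k$ is regarded as a left $A$-module, concentrated in degree $0$, on which $V$ acts by $0$. Put $n(2q)=qN$ and $n(2q+1)=qN+1$ for $q\ge 0$. Assume that $A$ is generalized Koszul, i.e. for every $i\ge 3$ the graded vector space $\mathrm{Tor}_i^A(k,k)$ (computed in the category of graded modules) is concentrated in degree $n(i)$, and that $A$ has finite global dimension $D$. Let $E(A)=\bigoplus_{i\ge 0}\mathrm{Ext}_A^i(k,k)$ be the Yoneda algebra of $A$, the $\mathrm{Ext}$ being taken in the category of all left $A$-modules. Then $E(A)$ is finite-dimensional over $k$, and the following are equivalent: (a) $A$ is AS-Gorenstein, i.e. $\mathrm{Ext}_A^i(k,A)=0$ for $i\ne D$, and $\mathrm{Ext}_A^D(k,A)\cong k$ (as a $k$-vector space and as a right $A$-module); (b) $E(A)$ is a Frobenius algebra, i.e. it is finite-dimensional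 and isomorphic to its dual $E(A)^*=\mathrm{Hom}_k(E(A),k)$ as a left $E(A)$-module. -/

import Mathlib

open CategoryTheory Abelian
open scoped DirectSum TensorProduct

universe u

noncomputable section

/-! ### Augmented algebras: trivial module, Yoneda algebra, AS-Gorenstein property -/

section Augmented

variable {k : Type u} [Field k] {A : Type u} [Ring A] [Algebra k A]

/-- The base field `k`, regarded as a left `A`-module through the augmentation `ε : A → k`. -/
def TrivialModule (_ : A →ₐ[k] k) : Type u := k

instance (ε : A →ₐ[k] k) : AddCommGroup (TrivialModule ε) :=
  inferInstanceAs (AddCommGroup k)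

instance (ε : A →ₐ[k] k) : Module A (TrivialModule ε) :=
  Module.compHom k ε.toRingHom

/-- The trivial left module `k` as an object of the category of left `A`-modules. -/
abbrev trivialModule (ε : A →ₐ[k] k) : ModuleCat.{u} A :=
  ModuleCat.of A (TrivialModule ε)

/-- The (left) global dimension of a ring: the supremum of the projective dimensions of all its
left modules. -/
def globalDimension (A : Type u) [Ring A] : WithBot ℕ∞ :=
  ⨆ M : ModuleCat.{u} A, projectiveDimension M

/-- Right multiplication by `a`, as an endomorphism of the left `A`-module `A`. -/
def rightMul (a : A) : ModuleCat.of A A ⟶ ModuleCat.of A A :=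
  ModuleCat.ofHom (LinearMap.toSpanSingleton A A a)

/-- An augmented `k`-algebra `A` is AS-Gorenstein if its global dimension is a natural number `D`,
`Ext_A^i(k, A) = 0` for `i ≠ D`, and `Ext_A^D(k, A)` is isomorphic to `k`, both as a `k`-vector
space and as a right `A`-module. The right action of `a : A` on `Ext_A^D(k, A)` is induced by right
multiplication by `a` on the coefficients, and the one on `k` is multiplication by `ε a`. -/
def IsASGorenstein (ε : A →ₐ[k] k) : Prop :=
  ∃ D : ℕ, globalDimension A = D ∧
    (∀ i : ℕ, i ≠ D → Subsingleton (Ext (trivialModule ε) (ModuleCat.of A A) i)) ∧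
    ∃ e : Ext (trivialModule ε) (ModuleCat.of A A) D ≃ₗ[k] k,
      ∀ (x : Ext (trivialModule ε) (ModuleCat.of A A) D) (a : A),
        e (x.comp (Ext.mk₀ (rightMul a)) (add_zero D)) = e x * ε a

/-- The graded pieces `E(A)_i = Ext_A^i(k, k)` of the Yoneda algebra. -/
abbrev YonedaExt (ε : A →ₐ[k] k) (i : ℕ) : Type u :=
  Ext (trivialModule ε) (trivialModule ε) i

/-- The Yoneda product of `f` and `g` is the composition "first `g`, then `f`". -/
def YonedaExt.mul {ε : A →ₐ[k] k} {i j : ℕ} (f : YonedaExt ε i) (g : YonedaExt ε j) :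
    YonedaExt ε (i + j) :=
  Ext.comp g f (add_comm j i)

theorem YonedaExt.mk_comp_eq {ε : A →ₐ[k] k} {a b c c' : ℕ} (α : YonedaExt ε a)
    (β : YonedaExt ε b) (h : a + b = c) (h' : a + b = c') :
    GradedMonoid.mk (A := YonedaExt ε) c (α.comp β h) = GradedMonoid.mk c' (α.comp β h') := by
  subst h; subst h'; rfl

theorem YonedaExt.mk_mul_mk₀_id {ε : A →ₐ[k] k} {i : ℕ} (f : YonedaExt ε i) :
    GradedMonoid.mk (A := YonedaExt ε) (i + 0)
      (YonedaExt.mul f (Ext.mk₀ (𝟙 (trivialModule ε)))) = GradedMonoid.mk i f := by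
  unfold YonedaExt.mul
  rw [YonedaExt.mk_comp_eq _ _ _ (zero_add i), Ext.mk₀_id_comp]

theorem YonedaExt.mk_mk₀_id_mul {ε : A →ₐ[k] k} {i : ℕ} (f : YonedaExt ε i) :
    GradedMonoid.mk (A := YonedaExt ε) (0 + i)
      (YonedaExt.mul (Ext.mk₀ (𝟙 (trivialModule ε))) f) = GradedMonoid.mk i f := by
  unfold YonedaExt.mul
  rw [YonedaExt.mk_comp_eq _ _ _ (add_zero i), Ext.comp_mk₀_id]

theorem YonedaExt.mk_mul_assoc {ε : A →ₐ[k] k} {a b c : ℕ} (f : YonedaExt ε a)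
    (g : YonedaExt ε b) (h : YonedaExt ε c) :
    GradedMonoid.mk (A := YonedaExt ε) (a + b + c) (YonedaExt.mul (YonedaExt.mul f g) h) =
      GradedMonoid.mk (a + (b + c)) (YonedaExt.mul f (YonedaExt.mul g h)) := by
  unfold YonedaExt.mul
  rw [← Ext.comp_assoc h g f (add_comm c b) (add_comm b a) (by omega : c + b + a = a + b + c)]
  exact YonedaExt.mk_comp_eq _ _ _ _

instance (ε : A →ₐ[k] k) : GradedMonoid.GOne (YonedaExt ε) where
  one := Ext.mk₀ (𝟙 (trivialModule ε))

instance (ε : A →ₐ[k] k) : GradedMonoid.GMul (YonedaExt ε) where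
  mul f g := YonedaExt.mul f g

instance (ε : A →ₐ[k] k) : GradedMonoid.GMonoid (YonedaExt ε) where
  one_mul f := YonedaExt.mk_mk₀_id_mul f.2
  mul_one f := YonedaExt.mk_mul_mk₀_id f.2
  mul_assoc f g h := YonedaExt.mk_mul_assoc f.2 g.2 h.2

instance (ε : A →ₐ[k] k) : DirectSum.GRing (YonedaExt ε) where
  mul_zero {i j} _ := Ext.zero_comp _ _ _ _ (add_comm j i)
  zero_mul {i j} _ := Ext.comp_zero _ _ _ _ (add_comm j i)
  mul_add {i j} _ _ _ := Ext.add_comp _ _ _ (add_comm j i)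
  add_mul {i j} _ _ _ := Ext.comp_add _ _ _ (add_comm j i)
  natCast n := n • Ext.mk₀ (𝟙 (trivialModule ε))
  natCast_zero := zero_smul _ _
  natCast_succ n := succ_nsmul _ n
  intCast n := n • Ext.mk₀ (𝟙 (trivialModule ε))
  intCast_ofNat n := natCast_zsmul _ n
  intCast_negSucc_ofNat n := negSucc_zsmul _ n

theorem YonedaExt.mk_smul_one_mul {ε : A →ₐ[k] k} (r : k) {i : ℕ} (f : YonedaExt ε i) :
    GradedMonoid.mk (A := YonedaExt ε) (0 + i)
      (YonedaExt.mul (r • Ext.mk₀ (𝟙 (trivialModule ε))) f) = GradedMonoid.mk i (r • f) := by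
  unfold YonedaExt.mul
  rw [YonedaExt.mk_comp_eq _ _ _ (add_zero i), Ext.comp_smul, Ext.comp_mk₀_id]

theorem YonedaExt.mk_mul_smul_one {ε : A →ₐ[k] k} (r : k) {i : ℕ} (f : YonedaExt ε i) :
    GradedMonoid.mk (A := YonedaExt ε) (i + 0)
      (YonedaExt.mul f (r • Ext.mk₀ (𝟙 (trivialModule ε)))) = GradedMonoid.mk i (r • f) := by
  unfold YonedaExt.mul
  rw [YonedaExt.mk_comp_eq _ _ _ (zero_add i), Ext.smul_comp, Ext.mk₀_id_comp]

instance (ε : A →ₐ[k] k) : DirectSum.GAlgebra k (YonedaExt ε) where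
  toFun :=
    { toFun := fun r => r • Ext.mk₀ (𝟙 (trivialModule ε))
      map_zero' := zero_smul k _
      map_add' := fun r s => add_smul r s _ }
  map_one := by
    change (1 : k) • Ext.mk₀ (𝟙 (trivialModule ε)) = Ext.mk₀ (𝟙 (trivialModule ε))
    rw [one_smul]
  map_mul r s := by
    change GradedMonoid.mk (A := YonedaExt ε) 0 ((r * s) • Ext.mk₀ (𝟙 (trivialModule ε))) =
      GradedMonoid.mk (0 + 0) (YonedaExt.mul (r • Ext.mk₀ (𝟙 (trivialModule ε)))
        (s • Ext.mk₀ (𝟙 (trivialModule ε))))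
    rw [YonedaExt.mk_smul_one_mul, mul_smul]
  commutes r x := by
    change GradedMonoid.mk (A := YonedaExt ε) (0 + x.1)
        (YonedaExt.mul (r • Ext.mk₀ (𝟙 (trivialModule ε))) x.2) =
      GradedMonoid.mk (x.1 + 0) (YonedaExt.mul x.2 (r • Ext.mk₀ (𝟙 (trivialModule ε))))
    rw [YonedaExt.mk_smul_one_mul, YonedaExt.mk_mul_smul_one]
  smul_def r x := by
    change GradedMonoid.mk (A := YonedaExt ε) x.1 (r • x.2) = GradedMonoid.mk (0 + x.1)
      (YonedaExt.mul (r • Ext.mk₀ (𝟙 (trivialModule ε))) x.2)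
    rw [YonedaExt.mk_smul_one_mul]

/-- The Yoneda algebra `E(A) = ⨁ i, Ext_A^i(k, k)`, a `k`-algebra for the Yoneda product. -/
abbrev YonedaAlgebra (ε : A →ₐ[k] k) : Type u := ⨁ i, YonedaExt ε i

end Augmented

/-- A `k`-algebra `E` is Frobenius if it is finite dimensional and isomorphic, as a left
`E`-module, to its dual `E* = Hom_k(E, k)`, where `(b • α) c = α (c * b)` for `α` in `E*`. -/
def IsFrobenius (k E : Type u) [Field k] [Ring E] [Algebra k E] : Prop :=
  Module.Finite k E ∧
    ∃ e : E ≃ₗ[k] Module.Dual k E, ∀ a b c : E, e (a * b) c = e b (c * a)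

/-! ### Graded projective resolutions and the graded `Tor` -/

section GradedTor

variable {k : Type u} [Field k] {A : Type u} [Ring A] [Algebra k A]

/-- A projective resolution `⋯ → P 1 → P 0 → k → 0` of the trivial module in the category of
`ℤ`-graded left `A`-modules and morphisms of degree `0`; here `A` carries the grading `𝒜` and `k` is
concentrated in degree `0`. (A graded module is projective in that category if and only if its
underlying module is projective.) -/
structure GradedResolution (𝒜 : ℕ → Submodule k A) (ε : A →ₐ[k] k) where
  P : ℕ → Type u
  [addCommGroup : ∀ i, AddCommGroup (P i)]
  [module : ∀ i, Module A (P i)]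
  projective : ∀ i, Module.Projective A (P i)
  /-- the homogeneous components of the terms -/
  deg : ∀ i, ℤ → AddSubgroup (P i)
  isInternal : ∀ i, DirectSum.IsInternal (deg i)
  smul_mem : ∀ (i m : ℕ) (j : ℤ), ∀ a ∈ 𝒜 m, ∀ x ∈ deg i j, a • x ∈ deg i (m + j)
  d : ∀ i, P (i + 1) →ₗ[A] P i
  d_mem : ∀ (i : ℕ) (j : ℤ), ∀ x ∈ deg (i + 1) j, d i x ∈ deg i j
  aug : P 0 →ₗ[A] TrivialModule ε
  aug_eq_zero : ∀ j : ℤ, j ≠ 0 → ∀ x ∈ deg 0 j, aug x = 0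
  aug_surjective : Function.Surjective aug
  exact_zero : Function.Exact (d 0) aug
  exact_succ : ∀ i, Function.Exact (d (i + 1)) (d i)

namespace GradedResolution

variable {𝒜 : ℕ → Submodule k A} {ε : A →ₐ[k] k} (P : GradedResolution 𝒜 ε)

instance (i : ℕ) : AddCommGroup (P.P i) := P.addCommGroup i

instance (i : ℕ) : Module A (P.P i) := P.module i

/-- `k ⊗_A P_i`, realized as `P_i / A₊ P_i` where `A₊ = ker ε`. -/
abbrev Q (i : ℕ) : Type u := P.P i ⧸ (RingHom.ker ε • (⊤ : Submodule A (P.P i)))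

/-- The differential of the complex `k ⊗_A P`. -/
def dQ (i : ℕ) : P.Q (i + 1) →ₗ[A] P.Q i :=
  Submodule.mapQ _ _ (P.d i) (by
    rw [← Submodule.map_le_iff_le_comap, Submodule.map_smul'']
    exact Submodule.smul_mono le_rfl le_top)

/-- The component of degree `j` of the graded vector space `k ⊗_A P_i`. -/
def degQ (i : ℕ) (j : ℤ) : AddSubgroup (P.Q i) :=
  (P.deg i j).map (Submodule.mkQ _).toAddMonoidHom

/-- The cycles of homological degree `i` and internal degree `j` of the complex `k ⊗_A P`. -/
def cycles : (i : ℕ) → (j : ℤ) → AddSubgroup (P.Q i)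
  | 0, j => P.degQ 0 j
  | i + 1, j => P.degQ (i + 1) j ⊓ (P.dQ i).toAddMonoidHom.ker

/-- The boundaries of homological degree `i` and internal degree `j` of the complex
`k ⊗_A P`. -/
def boundaries (i : ℕ) (j : ℤ) : AddSubgroup (P.Q i) :=
  (P.degQ (i + 1) j).map (P.dQ i).toAddMonoidHom

/-- The component of internal degree `j` of `Tor_i^A(k, k) = H_i(k ⊗_A P)`. -/
def Tor (i : ℕ) (j : ℤ) : Type u :=
  P.cycles i j ⧸ (P.boundaries i j).addSubgroupOf (P.cycles i j)

end GradedResolution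

end GradedTor

/-! ### `N`-homogeneous algebras -/

section Homogeneous

variable {k : Type u} [Field k] {V : Type u} [AddCommGroup V] [Module k V] {N : ℕ}

/-- The two-sided ideal `I(R)` of the tensor algebra of `V` generated by a subspace `R` of
`V^{⊗N}`. -/
def relationIdeal (R : Submodule k (⨂[k]^N V)) : TwoSidedIdeal (TensorAlgebra k V) :=
  TwoSidedIdeal.span (TensorPower.toTensorAlgebra '' (R : Set (⨂[k]^N V)))

/-- The `N`-homogeneous algebra `A = Tens(V) / I(R)` on `V` with space of relations `R`. -/
abbrev HomogeneousAlgebra (R : Submodule k (⨂[k]^N V)) : Type u :=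
  TensorAlgebra k V ⧸ (relationIdeal R).asIdeal

namespace HomogeneousAlgebra

variable (R : Submodule k (⨂[k]^N V))

/-- The homogeneous component `A_n` of `A`: the image of `V^{⊗n}`. -/
def component (n : ℕ) : Submodule k (HomogeneousAlgebra R) :=
  (LinearMap.range (TensorPower.toTensorAlgebra (R := k) (M := V) (n := n))).map
    (Ideal.Quotient.mkₐ k (relationIdeal R).asIdeal).toLinearMap

theorem algebraMapInv_eq_zero [N.AtLeastTwo] (x : TensorAlgebra k V)
    (hx : x ∈ (relationIdeal R).asIdeal) : TensorAlgebra.algebraMapInv x = 0 := by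
  have key : relationIdeal R ≤
      TwoSidedIdeal.ker (TensorAlgebra.algebraMapInv (R := k) (M := V)) := by
    refine TwoSidedIdeal.span_le.2 ?_
    rintro _ ⟨t, -, rfl⟩
    rw [SetLike.mem_coe, TwoSidedIdeal.mem_ker]
    induction t using PiTensorProduct.induction_on with
    | smul_tprod r f =>
      rw [map_smul, map_smul, TensorPower.toTensorAlgebra_tprod, TensorAlgebra.tprod_apply,
        map_list_prod]
      have hN : 0 < N := lt_of_lt_of_le Nat.zero_lt_two (Nat.AtLeastTwo.prop)
      rw [List.prod_eq_zero, smul_zero]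
      rw [List.map_ofFn, List.mem_ofFn]
      exact ⟨⟨0, hN⟩, by simp [TensorAlgebra.algebraMapInv]⟩
    | add x y hx hy => rw [map_add, map_add, hx, hy, add_zero]
  have h := key ((TwoSidedIdeal.mem_asIdeal).1 hx)
  rwa [TwoSidedIdeal.mem_ker] at h

/-- The augmentation `ε : A → k`, which sends the generators in `V` to `0`. -/
def augmentation [N.AtLeastTwo] : HomogeneousAlgebra R →ₐ[k] k :=
  Ideal.Quotient.liftₐ (relationIdeal R).asIdeal TensorAlgebra.algebraMapInv
    (algebraMapInv_eq_zero R)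

/-- The jump map: `n(2q) = qN` and `n(2q+1) = qN + 1`. -/
def jump (N i : ℕ) : ℕ := i / 2 * N + i % 2

/-- `A` is (generalized) Koszul if for each `i ≥ 3` the graded vector space `Tor_i^A(k, k)` is
concentrated in degree `n(i)`. The graded space `Tor_i^A(k, k)` is, up to isomorphism, the same for
all projective resolutions of `k` in the category of graded left `A`-modules. -/
def IsKoszul [N.AtLeastTwo] : Prop :=
  ∀ P : GradedResolution (component R) (augmentation R),
    ∀ i : ℕ, 3 ≤ i → ∀ j : ℤ, j ≠ (jump N i : ℤ) → Subsingleton (P.Tor i j)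

end HomogeneousAlgebra

end Homogeneous

end

/-! A linear form `φ` on Ext^d(k, k) gives, for every module M and every i + j = d, a pairing of
Ext^i(k, M) with Ext^j(M, k): compose, then apply `φ`. For M = k, perfectness of these pairings
amounts to the Frobenius property of E(A). For M = A, the space Ext^j(A, k) is k for j = 0 and zero
otherwise, so perfectness says that Ext^i(k, A) is one-dimensional for i = d and zero for i < d. The
proof transports perfectness between M = A and M = k by comparing the long exact sequence of Ext(k,
-) with the dual of that of Ext(-, k), as in the five lemma (`PairingSurjective.of_shortExact`,
`PairingInjective.of_shortExact`).

From A to k (`MinimalResolution.isFrobenius_of_isASGorenstein`): since A₊ acts by zero on Ext^D(k,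
A), the map Ext^D(k, A) → Ext^D(k, k) is injective, so some `φ` makes the pairing for A perfect. It
is then perfect for finite free modules, and the sequences 0 → Ω^{l+1} → P_l → Ω^l → 0 of a
resolution by finite free modules carry surjectivity to k = Ω^0.

From k to A (`MinimalResolution.isASGorenstein_of_pairing`): a nondegenerate form on E(A) forces the
elements killed on the left by E₊ to form a line, which must be the top nonzero degree d; hence the
restriction of the form to degree d has perfect pairings for M = k. Extensions carry injectivity to
every finite-dimensional nilpotent module, in particular to A/A_{≥n}. A class of Ext^i(k, A) which
pairs trivially with Ext^j(A, k) therefore dies in Ext^i(k, A/A_{≥n}) for all n, and a degree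
argument on the finite resolution shows that it is zero
(`MinimalResolution.ext_eq_zero_of_truncation`).

Two facts about A support this. The minimal graded resolution of k has finite terms: terms 1 and 2
because A₊ is finitely presented (generators from V, relations from R), the later ones because
Koszulity puts all generators in one degree, where there are only finitely many. Moreover the length
of this resolution bounds the projective dimension of all modules, graded or not: a module placed in
filtration degree 0 has a sum of copies of k as associated graded module, and graded resolutions
lift to filtered modules (`SymbolFiltration.hasProjectiveDimensionLT`). -/

/-! ### Yoneda pairings and long exact sequences -/

section ExtPairing

universe v w

variable {k : Type u} [Field k] {C : Type v} [Category.{w} C] [Abelian C] [Linear k C]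
  [HasExt.{u} C] {X : C} {d : ℕ}

/-- The Yoneda pairing `Ext^i(X, M) × Ext^j(M, X) → Ext^d(X, X) → k` is nondegenerate in the first
variable. -/
def PairingInjective (φ : Ext X X d →ₗ[k] k) (M : C) (i j : ℕ) (h : i + j = d) : Prop :=
  ∀ x : Ext X M i, (∀ y : Ext M X j, φ (x.comp y h) = 0) → x = 0

/-- Every linear form on `Ext^j(M, X)` is the Yoneda pairing with an element of `Ext^i(X, M)`. -/
def PairingSurjective (φ : Ext X X d →ₗ[k] k) (M : C) (i j : ℕ) (h : i + j = d) : Prop :=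
  ∀ ψ : Ext M X j →ₗ[k] k, ∃ x : Ext X M i, ∀ y, φ (x.comp y h) = ψ y

/-- Yoneda composition with a fixed class on the left, as a linear map. -/
noncomputable def extPrecomp (k : Type u) [Field k] {C : Type v} [Category.{w} C] [Abelian C]
    [Linear k C] [HasExt.{u} C] {L M : C} {a : ℕ} (x : Ext L M a) (Y : C) {b c : ℕ}
    (h : a + b = c) : Ext M Y b →ₗ[k] Ext L Y c where
  toFun y := x.comp y h
  map_add' _ _ := Ext.comp_add _ _ _ _
  map_smul' _ _ := Ext.comp_smul _ _ _ _

@[simp] theorem extPrecomp_apply {L M : C} {a : ℕ} (x : Ext L M a) (Y : C) {b c : ℕ}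
    (h : a + b = c) (y : Ext M Y b) : extPrecomp k x Y h y = x.comp y h := rfl

/-- Yoneda composition with a fixed class on the right, as a linear map. -/
noncomputable def extPostcomp (k : Type u) [Field k] {C : Type v} [Category.{w} C] [Abelian C]
    [Linear k C] [HasExt.{u} C] (L : C) {M Y : C} {b : ℕ} (y : Ext M Y b) {a c : ℕ}
    (h : a + b = c) : Ext L M a →ₗ[k] Ext L Y c where
  toFun x := x.comp y h
  map_add' _ _ := Ext.add_comp _ _ _ _
  map_smul' _ _ := Ext.smul_comp _ _ _ _

variable {φ : Ext X X d →ₗ[k] k} {S : ShortComplex C}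

/-- The form descends to the image of `f` and extends from there, k being a field. In the diagram
chases this replaces exactness of the dualized sequences. -/
theorem LinearMap.exists_comp_eq_of_ker_le {E F : Type*} [AddCommGroup E] [Module k E]
    [AddCommGroup F] [Module k F] (f : E →ₗ[k] F) (ψ : E →ₗ[k] k)
    (h : LinearMap.ker f ≤ LinearMap.ker ψ) : ∃ χ : F →ₗ[k] k, ∀ x, χ (f x) = ψ x := by
  have h' : f.ker ≤ LinearMap.ker ψ := h
  obtain ⟨χ, hχ⟩ := LinearMap.exists_extend
    ((f.ker.liftQ ψ h').comp f.quotKerEquivRange.symm.toLinearMap)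
  refine ⟨χ, fun x => ?_⟩
  have := LinearMap.congr_fun hχ ⟨f x, LinearMap.mem_range_self f x⟩
  simp only [LinearMap.comp_apply, Submodule.subtype_apply, LinearEquiv.coe_coe] at this
  rw [this]
  have h2 : f.quotKerEquivRange.symm ⟨f x, LinearMap.mem_range_self f x⟩ =
      Submodule.Quotient.mk x := by
    rw [LinearEquiv.symm_apply_eq]; rfl
  rw [h2]; rfl

/-- Restriction along an epimorphism is injective on Ext^0(-, X), so a form on the source extends to
the target; the class representing the extension is pushed forward along `g`. -/
theorem PairingSurjective.of_epi {M N : C} (g : M ⟶ N) [Epi g] (h : d + 0 = d)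
    (hM : PairingSurjective φ M d 0 h) : PairingSurjective φ N d 0 h := by
  intro ψ
  obtain ⟨χ, hχ⟩ := LinearMap.exists_comp_eq_of_ker_le
    (extPrecomp k (Ext.mk₀ g) X (zero_add 0)) ψ (by
      intro y hy
      have : y = 0 := Ext.precomp_mk₀_injective_of_epi X g (by
        simpa using hy)
      rw [this]; exact Submodule.zero_mem _)
  obtain ⟨x, hx⟩ := hM χ
  refine ⟨x.comp (Ext.mk₀ g) (add_zero d), fun y => ?_⟩
  rw [Ext.comp_assoc x (Ext.mk₀ g) y (add_zero d) (zero_add 0) (by lia), hx, ← hχ]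
  rfl

/-- Half of the four lemma. The form, pulled back along the connecting map, is represented by a
class `w` with values in `S.X₁`. Its image in `S.X₂` pairs to zero, hence vanishes, so `w` comes
from a class `x` with values in `S.X₃`. By `hF` the connecting map is onto Ext^{j+1}(S.X₃, X), so
`x` represents the form everywhere. -/
theorem PairingSurjective.of_shortExact (hS : S.ShortExact) {i j : ℕ} (h : i + (j + 1) = d)
    (h' : i + 1 + j = d) (hF : ∀ y : Ext S.X₂ X (j + 1), y = 0)
    (h₁ : PairingSurjective φ S.X₁ (i + 1) j h') (h₂ : PairingInjective φ S.X₂ (i + 1) j h') :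
    PairingSurjective φ S.X₃ i (j + 1) h := by
  intro ψ
  obtain ⟨w, hw⟩ := h₁ (ψ ∘ₗ extPrecomp k hS.extClass X (add_comm 1 j))
  have hw0 : w.comp (Ext.mk₀ S.f) (add_zero (i + 1)) = 0 := by
    apply h₂
    intro y
    rw [Ext.comp_assoc w (Ext.mk₀ S.f) y (add_zero _) (zero_add j) (by lia), hw]
    simp only [LinearMap.comp_apply, extPrecomp_apply]
    rw [← Ext.comp_assoc hS.extClass (Ext.mk₀ S.f) y (add_zero 1) (zero_add j) (by lia),
      hS.extClass_comp, Ext.zero_comp, map_zero]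
  obtain ⟨x, rfl⟩ := Ext.covariant_sequence_exact₁ _ hS w hw0 rfl
  refine ⟨x, fun y => ?_⟩
  obtain ⟨u, rfl⟩ := Ext.contravariant_sequence_exact₃ hS X y (hF _) (add_comm 1 j)
  rw [← Ext.comp_assoc x hS.extClass u rfl (add_comm 1 j) (by lia), hw]
  rfl

/-- The other half of the four lemma. In degree i = 0 there is no preceding term for `h₃'` to
control; the vanishing `h₀` takes its place. -/
theorem PairingInjective.of_shortExact (hS : S.ShortExact) {i j : ℕ} (h : i + j = d)
    (h₁ : PairingInjective φ S.X₁ i j h) (h₃ : PairingInjective φ S.X₃ i j h)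
    (h₃' : ∀ (i' : ℕ) (hi : i' + 1 = i), PairingSurjective φ S.X₃ i' (j + 1) (by lia))
    (h₀ : i = 0 → ∀ y : Ext S.X₃ X (j + 1), y = 0) :
    PairingInjective φ S.X₂ i j h := by
  intro x hx
  obtain ⟨x', rfl⟩ := Ext.covariant_sequence_exact₂ X hS x (by
    apply h₃
    intro y
    rw [Ext.comp_assoc x (Ext.mk₀ S.g) y (add_zero _) (zero_add j) (by lia), hx])
  -- A class on `S.X₁` killed by the connecting map extends to `S.X₂`, where the pairing with `x` is
  -- zero.
  have key : ∀ y : Ext S.X₁ X j, hS.extClass.comp y (add_comm 1 j) = 0 →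
      φ (x'.comp y h) = 0 := by
    intro y hy
    obtain ⟨z, rfl⟩ := Ext.contravariant_sequence_exact₁ hS X y _ hy
    rw [← Ext.comp_assoc x' (Ext.mk₀ S.f) z (add_zero _) (zero_add j) (by lia), hx]
  rcases i with - | i
  · have : x' = 0 := h₁ _ fun y => key y (h₀ rfl _)
    rw [this, Ext.zero_comp]
  -- By `key`, pairing with `x'` factors through the connecting map, so it is also pairing with some
  -- `w.comp hS.extClass`. Such classes die in `S.X₂`.
  · obtain ⟨χ, hχ⟩ := LinearMap.exists_comp_eq_of_ker_le
      (extPrecomp k hS.extClass X (add_comm 1 j)) (φ ∘ₗ extPrecomp k x' X h) key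
    obtain ⟨w, hw⟩ := h₃' i rfl χ
    have : x' = w.comp hS.extClass rfl := by
      rw [← sub_eq_zero]
      apply h₁
      intro y
      have h1 : (x' - w.comp hS.extClass rfl).comp y h =
          x'.comp y h - (w.comp hS.extClass rfl).comp y h :=
        (extPostcomp k X y h).map_sub _ _
      rw [h1, map_sub, sub_eq_zero,
        Ext.comp_assoc w hS.extClass y rfl (add_comm 1 j) (by lia), hw]
      exact (hχ y).symm
    rw [this, Ext.comp_assoc w hS.extClass _ rfl (add_zero 1) (by lia), hS.extClass_comp,
      Ext.comp_zero]

end ExtPairing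

/-! ### Gradings -/

/-- A `ℤ`-grading of a `k`-vector space, presented by its homogeneous projections. -/
structure VectorGrading (k : Type u) [Field k] (M : Type u) [AddCommGroup M] [Module k M] where
  piece : ℤ → Submodule k M
  proj : ℤ → M →ₗ[k] M
  proj_mem : ∀ n x, proj n x ∈ piece n
  proj_of_mem : ∀ n x, x ∈ piece n → proj n x = x
  proj_of_ne : ∀ m n x, x ∈ piece m → m ≠ n → proj n x = 0
  exists_sum : ∀ x, ∃ s : Finset ℤ, ∑ n ∈ s, proj n x = x

namespace VectorGrading

variable {k : Type u} [Field k] {M : Type u} [AddCommGroup M] [Module k M]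
  (G : VectorGrading k M)

theorem proj_proj (m n : ℤ) (x : M) : G.proj n (G.proj m x) = if m = n then G.proj m x else 0 := by
  split_ifs with h
  · subst h; exact G.proj_of_mem _ _ (G.proj_mem _ _)
  · exact G.proj_of_ne _ _ _ (G.proj_mem _ _) h

theorem proj_sum (s : Finset ℤ) (n : ℤ) (x : M) :
    G.proj n (∑ m ∈ s, G.proj m x) = if n ∈ s then G.proj n x else 0 := by
  rw [map_sum]
  simp only [proj_proj]
  rw [Finset.sum_ite_eq']

theorem exists_support (x : M) : ∃ s : Finset ℤ, (∀ n, n ∉ s → G.proj n x = 0) ∧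
    ∀ t : Finset ℤ, s ⊆ t → ∑ n ∈ t, G.proj n x = x := by
  obtain ⟨s, hs⟩ := G.exists_sum x
  have h : ∀ n, n ∉ s → G.proj n x = 0 := fun n hn => by
    rw [← hs, proj_sum, if_neg hn]
  refine ⟨s, h, fun t ht => ?_⟩
  rw [← Finset.sum_subset ht fun n _ hn => h n hn, hs]

theorem eq_zero_of_proj {x : M} (h : ∀ n, G.proj n x = 0) : x = 0 := by
  obtain ⟨s, hs⟩ := G.exists_sum x
  rw [← hs]
  exact Finset.sum_eq_zero fun n _ => h n

theorem ext_proj {x y : M} (h : ∀ n, G.proj n x = G.proj n y) : x = y := by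
  rw [← sub_eq_zero]
  exact G.eq_zero_of_proj fun n => by rw [map_sub, h, sub_self]

theorem map_proj {M' : Type u} [AddCommGroup M'] [Module k M'] (G' : VectorGrading k M')
    {F : Type*} [FunLike F M M'] [AddMonoidHomClass F M M'] (T : F)
    (hT : ∀ n, ∀ x ∈ G.piece n, T x ∈ G'.piece n) (n : ℤ) (x : M) :
    T (G.proj n x) = G'.proj n (T x) := by
  obtain ⟨s, -, hs⟩ := G.exists_support x
  conv_rhs => rw [← hs (insert n s) (Finset.subset_insert _ _)]
  rw [map_sum, map_sum, Finset.sum_eq_single n]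
  · exact (G'.proj_of_mem _ _ (hT _ _ (G.proj_mem _ _))).symm
  · exact fun m _ hm => G'.proj_of_ne _ _ _ (hT _ _ (G.proj_mem _ _)) hm
  · exact fun h => absurd (Finset.mem_insert_self _ _) h

/-- A submodule is homogeneous if it contains the homogeneous components of its elements. -/
def IsHomogeneous {A : Type u} [Ring A] [Module A M] (Z : Submodule A M) : Prop :=
  ∀ x ∈ Z, ∀ n, G.proj n x ∈ Z

theorem isHomogeneous_ker {M' : Type u} [AddCommGroup M'] [Module k M'] (G' : VectorGrading k M')
    {A : Type u} [Ring A] [Module A M] [Module A M'] (T : M →ₗ[A] M')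
    (hT : ∀ n, ∀ x ∈ G.piece n, T x ∈ G'.piece n) : G.IsHomogeneous (LinearMap.ker T) := by
  intro x hx n
  rw [LinearMap.mem_ker] at hx ⊢
  rw [G.map_proj G' T hT, hx, map_zero]

theorem isHomogeneous_range {M' : Type u} [AddCommGroup M'] [Module k M'] (G' : VectorGrading k M')
    {A : Type u} [Ring A] [Module A M] [Module A M'] (T : M →ₗ[A] M')
    (hT : ∀ n, ∀ x ∈ G.piece n, T x ∈ G'.piece n) : G'.IsHomogeneous (LinearMap.range T) := by
  rintro _ ⟨x, rfl⟩ n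
  exact ⟨_, G.map_proj G' T hT n x⟩

end VectorGrading

/-- A connected, locally finite `ℕ`-grading (extended by zero to `ℤ`) of an augmented algebra. -/
structure ConnectedGrading {k : Type u} [Field k] {A : Type u} [Ring A] [Algebra k A]
    (ε : A →ₐ[k] k) extends VectorGrading k A where
  mul_mem : ∀ m n a b, a ∈ piece m → b ∈ piece n → a * b ∈ piece (m + n)
  eq_bot : ∀ n < 0, piece n = ⊥
  finite : ∀ n, Module.Finite k (piece n)
  one_mem : 1 ∈ piece 0
  mem_zero : ∀ a ∈ piece 0, a = algebraMap k A (ε a)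
  aug_eq_zero : ∀ n a, a ∈ piece n → n ≠ 0 → ε a = 0

namespace ConnectedGrading

variable {k : Type u} [Field k] {A : Type u} [Ring A] [Algebra k A] {ε : A →ₐ[k] k}
  (G : ConnectedGrading ε)

theorem proj_neg {n : ℤ} (hn : n < 0) (a : A) : G.proj n a = 0 := by
  have := G.proj_mem n a
  rwa [G.eq_bot n hn, Submodule.mem_bot] at this

theorem proj_mul {m : ℤ} {a : A} (ha : a ∈ G.piece m) (n : ℤ) (b : A) :
    G.proj n (a * b) = a * G.proj (n - m) b := by
  obtain ⟨s, -, hs⟩ := G.exists_support b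
  conv_lhs => rw [← hs (insert (n - m) s) (Finset.subset_insert _ _)]
  rw [Finset.mul_sum, map_sum, Finset.sum_eq_single (n - m)]
  · exact G.proj_of_mem _ _ (by simpa using G.mul_mem m (n - m) _ _ ha (G.proj_mem _ _))
  · exact fun l _ hl => G.proj_of_ne _ _ _ (G.mul_mem m l _ _ ha (G.proj_mem _ _)) (by lia)
  · exact fun h => absurd (Finset.mem_insert_self _ _) h

theorem aug_proj_zero (a : A) : ε (G.proj 0 a) = ε a := by
  obtain ⟨s, -, hs⟩ := G.exists_support a
  conv_rhs => rw [← hs (insert 0 s) (Finset.subset_insert _ _)]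
  rw [map_sum, Finset.sum_eq_single 0]
  · exact fun l _ hl => G.aug_eq_zero _ _ (G.proj_mem _ _) hl
  · exact fun h => absurd (Finset.mem_insert_self _ _) h

theorem proj_zero (a : A) : G.proj 0 a = algebraMap k A (ε a) := by
  rw [G.mem_zero _ (G.proj_mem 0 a), aug_proj_zero]

theorem proj_nonpos {a : A} (ha : ε a = 0) {n : ℤ} (hn : n ≤ 0) : G.proj n a = 0 := by
  rcases hn.lt_or_eq with h | rfl
  · exact G.proj_neg h a
  · rw [proj_zero, ha, map_zero]

variable {ι : Type u} (δ : ι → ℤ)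

/-- The grading of the free module on a basis with prescribed degrees. -/
noncomputable def free : VectorGrading k (ι →₀ A) where
  piece n :=
    { carrier := {f | ∀ b, f b ∈ G.piece (n - δ b)}
      add_mem' := fun hf hg b => add_mem (hf b) (hg b)
      zero_mem' := fun b => zero_mem _
      smul_mem' := fun c _ hf b => Submodule.smul_mem _ c (hf b) }
  proj n := Finsupp.lsum k fun b => Finsupp.lsingle b ∘ₗ G.proj (n - δ b)
  proj_mem n f := by
    classical
    induction f using Finsupp.induction_linear with
    | zero => rw [map_zero]; exact zero_mem _
    | add f g hf hg => rw [map_add]; exact add_mem hf hg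
    | single b a =>
      intro c
      simp only [Finsupp.lsum_single, LinearMap.comp_apply, Finsupp.lsingle_apply]
      rw [Finsupp.single_apply]
      split_ifs with h
      · subst h; exact G.proj_mem _ _
      · exact zero_mem _
  proj_of_mem n f hf := by
    rw [Finsupp.lsum_apply]
    conv_rhs => rw [← Finsupp.sum_single f]
    refine Finsupp.sum_congr fun b _ => ?_
    simp only [LinearMap.comp_apply, Finsupp.lsingle_apply]
    rw [G.proj_of_mem _ _ (hf b)]
  proj_of_ne m n f hf hmn := by
    rw [Finsupp.lsum_apply]
    refine Finset.sum_eq_zero fun b _ => ?_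
    simp only [LinearMap.comp_apply, Finsupp.lsingle_apply]
    rw [G.proj_of_ne _ _ _ (hf b) (by lia), Finsupp.single_zero]
  exists_sum f := by
    suffices h : ∃ s : Finset ℤ, ∀ t : Finset ℤ, s ⊆ t →
        ∑ n ∈ t, Finsupp.lsum k (fun b => Finsupp.lsingle b ∘ₗ G.proj (n - δ b)) f = f by
      obtain ⟨s, hs⟩ := h
      exact ⟨s, hs s subset_rfl⟩
    induction f using Finsupp.induction_linear with
    | zero => exact ⟨∅, fun t _ => by simp⟩
    | add f g hf hg =>
      obtain ⟨s, hs⟩ := hf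
      obtain ⟨s', hs'⟩ := hg
      refine ⟨s ∪ s', fun t ht => ?_⟩
      simp only [map_add, Finset.sum_add_distrib]
      rw [hs t (Finset.union_subset_left ht), hs' t (Finset.union_subset_right ht)]
    | single b a =>
      obtain ⟨s, -, hs⟩ := G.exists_support a
      refine ⟨s.map (addRightEmbedding (δ b)), fun t ht => ?_⟩
      simp only [Finsupp.lsum_single, LinearMap.comp_apply]
      rw [← map_sum]
      have := hs (t.map (addRightEmbedding (-δ b))) (fun n hn => by
        rw [Finset.mem_map]
        refine ⟨n + δ b, ht (Finset.mem_map.2 ⟨n, hn, rfl⟩), by simp⟩)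
      rw [Finset.sum_map] at this
      simp only [addRightEmbedding_apply, ← sub_eq_add_neg] at this
      rw [this, Finsupp.lsingle_apply]

theorem free_proj_apply (n : ℤ) (f : ι →₀ A) (b : ι) :
    (G.free δ).proj n f b = G.proj (n - δ b) (f b) := by
  classical
  induction f using Finsupp.induction_linear with
  | zero => simp
  | add f g hf hg => simp only [map_add, Finsupp.add_apply, hf, hg]
  | single c a =>
    have : (G.free δ).proj n (Finsupp.single c a) = Finsupp.single c (G.proj (n - δ c) a) := by
      simp [free]
    rw [this, Finsupp.single_apply, Finsupp.single_apply]
    split_ifs with h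
    · subst h; rfl
    · rw [map_zero]

theorem single_mem_free {b : ι} {a : A} {m : ℤ} (ha : a ∈ G.piece m) {n : ℤ} (h : m + δ b = n) :
    Finsupp.single b a ∈ (G.free δ).piece n := by
  classical
  intro c
  rw [Finsupp.single_apply]
  split_ifs with hc
  · subst hc; rwa [← h, add_sub_cancel_right]
  · exact zero_mem _

theorem smul_mem_free {m n : ℤ} {a : A} {f : ι →₀ A} (ha : a ∈ G.piece m)
    (hf : f ∈ (G.free δ).piece n) : a • f ∈ (G.free δ).piece (m + n) := by
  intro b
  have := G.mul_mem _ _ _ _ ha (hf b)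
  rwa [← add_sub_assoc] at this

theorem free_proj_smul {m : ℤ} {a : A} (ha : a ∈ G.piece m) (n : ℤ) (f : ι →₀ A) :
    (G.free δ).proj n (a • f) = a • (G.free δ).proj (n - m) f := by
  ext b
  rw [free_proj_apply, Finsupp.smul_apply, Finsupp.smul_apply, free_proj_apply, smul_eq_mul,
    smul_eq_mul, G.proj_mul ha]
  congr 2
  lia

theorem free_proj_neg {δ : ι → ℤ} (hδ : ∀ b, 0 ≤ δ b) {n : ℤ} (hn : n < 0) (f : ι →₀ A) :
    (G.free δ).proj n f = 0 := by
  ext b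
  rw [free_proj_apply, G.proj_neg (by have := hδ b; lia), Finsupp.zero_apply]

/-- Only the finitely many basis vectors of degree at most `n` contribute. This local finiteness
bounds the number of new generators in each degree of a minimal cover. -/
theorem finite_free_piece {δ : ι → ℤ} (hδ : ∀ b, 0 ≤ δ b) (hfin : ∀ n, {b | δ b = n}.Finite)
    (n : ℤ) : Module.Finite k ((G.free δ).piece n) := by
  have hT : {b | δ b ≤ n}.Finite := by
    have : {b | δ b ≤ n} = ⋃ m ∈ Set.Icc 0 n, {b | δ b = m} := by
      ext b; simp [hδ b]
    rw [this]
    exact (Set.finite_Icc 0 n).biUnion fun m _ => hfin m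
  have := hT.to_subtype
  have := G.finite
  let L : (G.free δ).piece n →ₗ[k] (∀ b : {b | δ b ≤ n}, G.piece (n - δ b)) :=
    { toFun := fun f b => ⟨f.1 b, f.2 b⟩
      map_add' := fun _ _ => rfl
      map_smul' := fun _ _ => rfl }
  refine Module.Finite.of_injective L fun f g hfg => Subtype.ext (Finsupp.ext fun b => ?_)
  by_cases hb : δ b ≤ n
  · exact congrArg Subtype.val (congrFun hfg ⟨b, hb⟩)
  · have h0 : ∀ f : (G.free δ).piece n, f.1 b = 0 := fun f => by
      have := f.2 b
      rwa [G.eq_bot _ (by lia), Submodule.mem_bot] at this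
    rw [h0, h0]

/-- Elements of A₊ strictly raise degrees, so the degree `n` part of A₊Z involves only parts of Z of
degree less than `n`. This is the inductive step of Nakayama's lemma. -/
theorem free_proj_mem_of_mem_aug_smul {δ : ι → ℤ} {Z R : Submodule A (ι →₀ A)} {n : ℤ}
    (h : ∀ m < n, ∀ z ∈ Z, (G.free δ).proj m z ∈ R) {w : ι →₀ A} (hw : w ∈ RingHom.ker ε • Z) :
    (G.free δ).proj n w ∈ R := by
  induction hw using Submodule.smul_induction_on' with
  | smul a ha z hz =>
    obtain ⟨s, hs⟩ := G.exists_sum a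
    rw [← hs, Finset.sum_smul, map_sum]
    refine Submodule.sum_mem _ fun l _ => ?_
    rw [free_proj_smul _ _ (G.proj_mem l a)]
    rcases le_or_gt l 0 with hl | hl
    · rw [G.proj_nonpos ha hl, zero_smul]
      exact zero_mem _
    · exact Submodule.smul_mem _ _ (h _ (by lia) z hz)
  | add x _ y _ hx hy => rw [map_add]; exact add_mem hx hy

/-- Graded Nakayama lemma. -/
theorem le_of_le_sup_aug_smul {δ : ι → ℤ} (hδ : ∀ b, 0 ≤ δ b) {Z R : Submodule A (ι →₀ A)}
    (hR : (G.free δ).IsHomogeneous R) (h : Z ≤ R ⊔ RingHom.ker ε • Z) : Z ≤ R := by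
  -- The induction starts because nothing lives in negative degrees, all generators having
  -- nonnegative degree.
  have key : ∀ n : ℕ, ∀ m : ℤ, m < n → ∀ z ∈ Z, (G.free δ).proj m z ∈ R := by
    intro n
    induction n with
    | zero => intro m hm z _; rw [G.free_proj_neg hδ (by simpa using hm)]; exact zero_mem _
    | succ n ih =>
      intro m hm z hz
      obtain ⟨r, hr, w, hw, rfl⟩ := Submodule.mem_sup.1 (h hz)
      rw [map_add]
      exact add_mem (hR _ hr _) (G.free_proj_mem_of_mem_aug_smul
        (fun l hl z' hz' => ih l (by push_cast at hm; lia) z' hz') hw)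
  intro z hz
  obtain ⟨s, hs⟩ := (G.free δ).exists_sum z
  rw [← hs]
  exact Submodule.sum_mem _ fun m _ => key (m.toNat + 1) m (by push_cast; lia) z hz

end ConnectedGrading

/-! ### Minimal graded free covers -/

namespace ConnectedGrading

variable {k : Type u} [Field k] {A : Type u} [Ring A] [Algebra k A] {ε : A →ₐ[k] k}
  (G : ConnectedGrading ε)

/-- A acts on Z / A₊Z through `ε`. -/
theorem smul_sub_aug_smul_mem {M : Type*} [AddCommGroup M] [Module k M] [Module A M]
    [IsScalarTower k A M] (Z : Submodule A M) (a : A) {z : M} (hz : z ∈ Z) :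
    a • z - ε a • z ∈ RingHom.ker ε • Z := by
  have h : a • z - ε a • z = (a - algebraMap k A (ε a)) • z := by
    rw [sub_smul, algebraMap_smul]
  rw [h]
  exact Submodule.smul_mem_smul (by rw [RingHom.mem_ker]; simp) hz

theorem mem_aug_smul_top {ι : Type u} {f : ι →₀ A} :
    f ∈ (RingHom.ker ε • ⊤ : Submodule A (ι →₀ A)) ↔ ∀ b, ε (f b) = 0 := by
  constructor
  · intro hf b
    induction hf using Submodule.smul_induction_on' with
    | smul a ha z hz => rw [Finsupp.smul_apply, smul_eq_mul, map_mul, RingHom.mem_ker.1 ha, zero_mul]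
    | add x _ y _ hx hy => rw [Finsupp.add_apply, map_add, hx, hy, add_zero]
  · intro h
    rw [← Finsupp.sum_single f]
    refine Submodule.sum_mem _ fun b _ => ?_
    rw [← mul_one (f b), ← smul_eq_mul, ← Finsupp.smul_single]
    exact Submodule.smul_mem_smul (RingHom.mem_ker.2 (h b)) trivial

/-- A homogeneous submodule of a graded free module has a minimal graded free cover. -/
theorem exists_minimal_cover {ι : Type u} {δ : ι → ℤ} (hδ : ∀ b, 0 ≤ δ b)
    (hfin : ∀ n, {b | δ b = n}.Finite) (Z : Submodule A (ι →₀ A))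
    (hZ : (G.free δ).IsHomogeneous Z) :
    ∃ (ι' : Type u) (δ' : ι' → ℤ) (d : (ι' →₀ A) →ₗ[A] (ι →₀ A)), (∀ b, 0 ≤ δ' b) ∧
      (∀ n, {b | δ' b = n}.Finite) ∧
      (∀ n, ∀ x ∈ (G.free δ').piece n, d x ∈ (G.free δ).piece n) ∧
      LinearMap.range d = Z ∧ LinearMap.ker d ≤ RingHom.ker ε • ⊤ ∧ (Z.FG → Finite ι') := by
  classical
  let W : Submodule A (ι →₀ A) := RingHom.ker ε • Z
  -- The vector space Z / A₊Z is viewed inside the quotient of the ambient free module, so that no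
  -- quotient of `Z` itself is needed.
  let q : (ι →₀ A) →ₗ[k] ((ι →₀ A) ⧸ W) := W.mkQ.restrictScalars k
  have hq : ∀ x y, q x = q y ↔ x - y ∈ W := fun x y => Submodule.Quotient.eq W
  -- As `Z` is homogeneous, classes of homogeneous elements span Z / A₊Z. A basis chosen among them
  -- has homogeneous representatives `g`, which become the generators.
  let T : Set ((ι →₀ A) ⧸ W) := q '' {z | z ∈ Z ∧ ∃ n, z ∈ (G.free δ).piece n}
  obtain ⟨b, hbT, hspan, hli⟩ := exists_linearIndependent k T
  choose g hg using fun x : b => hbT x.2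
  choose δ' hδ' using fun x => (hg x).1.2
  have hgZ : ∀ x, g x ∈ Z := fun x => (hg x).1.1
  have hqg : ∀ x, q (g x) = x := fun x => (hg x).2
  have hlig : LinearIndependent k (q ∘ g) := by
    have : q ∘ g = ((↑) : b → _) := funext hqg
    rw [this]; exact hli
  have hlig' : LinearIndependent k g := LinearIndependent.of_comp q hlig
  let d : (b →₀ A) →ₗ[A] (ι →₀ A) := Finsupp.linearCombination A g
  have hd : ∀ n, ∀ x ∈ (G.free δ').piece n, d x ∈ (G.free δ).piece n := by
    intro n x hx
    change Finsupp.linearCombination A g x ∈ _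
    rw [Finsupp.linearCombination_apply]
    refine Submodule.sum_mem _ fun c _ => ?_
    have := G.smul_mem_free δ (hx c) (hδ' c)
    rwa [sub_add_cancel] at this
  have hrange : LinearMap.range d = Z := by
    refine le_antisymm ?_ ?_
    · change LinearMap.range (Finsupp.linearCombination A g) ≤ Z
      rw [Finsupp.range_linearCombination, Submodule.span_le]
      rintro _ ⟨x, rfl⟩
      exact hgZ x
    · refine G.le_of_le_sup_aug_smul hδ (VectorGrading.isHomogeneous_range _ _ d hd) ?_
      intro z hz
      have hz' : q z ∈ Submodule.span k (Set.range (q ∘ g)) := by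
        have h1 : Set.range (q ∘ g) = b := by
          have : q ∘ g = ((↑) : b → _) := funext hqg
          rw [this, Subtype.range_coe]
        rw [h1, hspan]
        obtain ⟨s, hs⟩ := (G.free δ).exists_sum z
        rw [← hs, map_sum]
        exact Submodule.sum_mem _ fun n _ =>
          Submodule.subset_span ⟨_, ⟨hZ z hz n, n, (G.free δ).proj_mem _ _⟩, rfl⟩
      rw [Set.range_comp, ← Submodule.map_span] at hz'
      obtain ⟨r, hr, hrz⟩ := hz'
      rw [← add_sub_cancel r z]
      refine Submodule.add_mem_sup ?_ ((hq _ _).1 hrz.symm)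
      change r ∈ (LinearMap.range d).restrictScalars k
      refine (Submodule.span_le.2 ?_) hr
      rintro _ ⟨x, rfl⟩
      exact ⟨Finsupp.single x 1, by simp [d]⟩
  refine ⟨b, δ', d, fun x => ?_, fun n => ?_, hd, hrange, ?_, fun hFG => ?_⟩
  · by_contra hneg
    have h0 := (G.free δ).proj_of_mem _ _ (hδ' x)
    rw [G.free_proj_neg hδ (by lia)] at h0
    exact hlig'.ne_zero x h0.symm
  · have := G.finite_free_piece hδ hfin n
    have hli2 : LinearIndependent k (fun x : {x | δ' x = n} =>
        (⟨g x, by have := hδ' x; rwa [x.2] at this⟩ : (G.free δ).piece n)) := by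
      refine LinearIndependent.of_comp ((G.free δ).piece n).subtype ?_
      exact hlig'.comp (fun x : {x | δ' x = n} => (x : b)) Subtype.val_injective
    exact Set.finite_coe_iff.1 hli2.finite
  · intro f hf
    rw [mem_aug_smul_top]
    -- Minimality: modulo A₊Z, a relation between the generators becomes a linear relation with
    -- coefficients `ε (f x)`, and the classes of the generators are independent.
    have h1 : q (∑ x ∈ f.support, ε (f x) • g x) = 0 := by
      have h2 : (0 : ι →₀ A) = ∑ x ∈ f.support, f x • g x := by
        rw [LinearMap.mem_ker] at hf
        rw [← hf]
        change Finsupp.linearCombination A g f = _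
        rw [Finsupp.linearCombination_apply, Finsupp.sum]
      rw [← map_zero q, eq_comm, hq, h2, ← Finset.sum_sub_distrib]
      exact Submodule.sum_mem _ fun x _ => smul_sub_aug_smul_mem Z (f x) (hgZ x)
    rw [map_sum] at h1
    simp only [map_smul] at h1
    intro x
    by_cases hx : x ∈ f.support
    · exact linearIndependent_iff'.1 hlig f.support (fun x => ε (f x)) h1 x hx
    · rw [Finsupp.notMem_support_iff.1 hx, map_zero]
  · obtain ⟨S, hS⟩ := hFG
    -- Generators of `Z` over A span Z / A₊Z over k, which bounds the independent family `q ∘ g`.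
    have hle : Set.range (q ∘ g) ≤ (Submodule.span k (q '' (S : Set (ι →₀ A))) : Set _) := by
      rintro _ ⟨x, rfl⟩
      have hz := hgZ x
      have : ∀ z ∈ Z, q z ∈ Submodule.span k (q '' (S : Set (ι →₀ A))) := by
        intro z hz
        rw [← hS] at hz
        induction hz using Submodule.span_induction with
        | mem z hz => exact Submodule.subset_span ⟨z, hz, rfl⟩
        | zero => rw [map_zero]; exact zero_mem _
        | add x y _ _ hx hy => rw [map_add]; exact add_mem hx hy
        | smul a z hz h =>
          have : q (a • z) = ε a • q z := by
            rw [← map_smul, hq]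
            exact smul_sub_aug_smul_mem Z a (hS ▸ hz)
          rw [this]
          exact Submodule.smul_mem _ _ h
      exact this _ hz
    have : Finite (q '' (S : Set (ι →₀ A))) := (S.finite_toSet.image q).to_subtype
    exact hlig.finite_of_le_span_finite _ _ hle

end ConnectedGrading

/-! ### The minimal graded resolution of the trivial module -/

section MinimalResolution

variable {k : Type u} [Field k] {A : Type u} [Ring A] [Algebra k A] {ε : A →ₐ[k] k}

theorem TrivialModule.smul_def (a : A) (x : TrivialModule ε) : a • x = (ε a * (show k from x) : k) :=
  rfl

/-- The generator `1` of the trivial module. -/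
def TrivialModule.one (ε : A →ₐ[k] k) : TrivialModule ε := (1 : k)

theorem TrivialModule.smul_one (a : A) : a • TrivialModule.one ε = (ε a : k) := mul_one (ε a)

/-- A minimal graded free resolution of the trivial module, starting with the free module of rank
one. -/
structure MinimalResolution (G : ConnectedGrading ε) where
  ι : ℕ → Type u
  δ : ∀ i, ι i → ℤ
  δ_nonneg : ∀ i b, 0 ≤ δ i b
  finite_fiber : ∀ i n, {b | δ i b = n}.Finite
  d : ∀ i, (ι (i + 1) →₀ A) →ₗ[A] (ι i →₀ A)
  d_mem : ∀ i n, ∀ x ∈ (G.free (δ (i + 1))).piece n, d i x ∈ (G.free (δ i)).piece n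
  range_succ : ∀ i, LinearMap.range (d (i + 1)) = LinearMap.ker (d i)
  ker_le : ∀ i, LinearMap.ker (d i) ≤ RingHom.ker ε • ⊤
  unique_zero : Unique (ι 0)
  δ_zero : ∀ b, δ 0 b = 0
  aug : (ι 0 →₀ A) →ₗ[A] TrivialModule ε
  aug_single : ∀ b a, aug (Finsupp.single b a) = (ε a : k)
  ker_aug : LinearMap.ker aug = RingHom.ker ε • ⊤
  range_zero : LinearMap.range (d 0) = LinearMap.ker aug
  finite_of_fg : ∀ i, (LinearMap.range (d i)).FG → Finite (ι (i + 1))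

/-- A homogeneous submodule of a graded free module. -/
structure HomogeneousSyzygy (G : ConnectedGrading ε) where
  ι : Type u
  δ : ι → ℤ
  δ_nonneg : ∀ b, 0 ≤ δ b
  finite_fiber : ∀ n, {b | δ b = n}.Finite
  Z : Submodule A (ι →₀ A)
  isHomogeneous : (G.free δ).IsHomogeneous Z

/-- The kernel of a minimal cover is again a homogeneous submodule of a locally finite graded free
module, so the construction can be iterated. -/
theorem HomogeneousSyzygy.exists_next {G : ConnectedGrading ε} (S : HomogeneousSyzygy G) :
    ∃ (T : HomogeneousSyzygy G) (d : (T.ι →₀ A) →ₗ[A] (S.ι →₀ A)),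
      (∀ n, ∀ x ∈ (G.free T.δ).piece n, d x ∈ (G.free S.δ).piece n) ∧
      LinearMap.range d = S.Z ∧ LinearMap.ker d = T.Z ∧
      T.Z ≤ RingHom.ker ε • ⊤ ∧ (S.Z.FG → Finite T.ι) := by
  obtain ⟨ι', δ', d, h0, hf, hd, hr, hk, hfg⟩ :=
    G.exists_minimal_cover S.δ_nonneg S.finite_fiber S.Z S.isHomogeneous
  exact ⟨⟨ι', δ', h0, hf, LinearMap.ker d, VectorGrading.isHomogeneous_ker _ _ d hd⟩,
    d, hd, hr, rfl, hk, hfg⟩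

/-- Iterate minimal covers, starting from A₊ inside the free module on one generator of degree 0. -/
theorem exists_minimalResolution (G : ConnectedGrading ε) : Nonempty (MinimalResolution G) := by
  classical
  choose next d hd hr hk hle hfg using fun S : HomogeneousSyzygy G => S.exists_next
  let aug : (PUnit.{u + 1} →₀ A) →ₗ[A] TrivialModule ε :=
    Finsupp.linearCombination A fun _ => TrivialModule.one ε
  have haug : ∀ b a, aug (Finsupp.single b a) = (ε a : k) := fun b a => by
    simp only [aug, Finsupp.linearCombination_single]
    exact TrivialModule.smul_one a
  have haug' : ∀ f : PUnit.{u + 1} →₀ A, aug f = (ε (f PUnit.unit) : k) := fun f => by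
    conv_lhs => rw [Finsupp.unique_single f]
    exact haug _ _
  have hker : LinearMap.ker aug = RingHom.ker ε • ⊤ := by
    ext f
    rw [LinearMap.mem_ker, haug', ConnectedGrading.mem_aug_smul_top]
    exact ⟨fun h b => h, fun h => h _⟩
  let S : HomogeneousSyzygy G :=
    { ι := PUnit
      δ := fun _ => 0
      δ_nonneg := fun _ => le_rfl
      finite_fiber := fun _ => Set.toFinite _
      Z := LinearMap.ker aug
      isHomogeneous := by
        intro f hf n
        rw [LinearMap.mem_ker, haug'] at hf ⊢
        rw [G.free_proj_apply]
        by_cases hn : n = 0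
        · subst hn
          rw [sub_zero, G.aug_proj_zero, hf]
        · exact G.aug_eq_zero _ _ (G.proj_mem _ _) (by simpa using hn) }
  let seq : ℕ → HomogeneousSyzygy G := fun i => Nat.rec S (fun _ T => next T) i
  exact ⟨{
    ι := fun i => (seq i).ι
    δ := fun i => (seq i).δ
    δ_nonneg := fun i => (seq i).δ_nonneg
    finite_fiber := fun i => (seq i).finite_fiber
    d := fun i => d (seq i)
    d_mem := fun i => hd (seq i)
    range_succ := fun i => (hr (seq (i + 1))).trans (hk (seq i)).symm
    ker_le := fun i => (hk (seq i)).trans_le (hle (seq i))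
    unique_zero := inferInstanceAs (Unique PUnit)
    δ_zero := fun _ => rfl
    aug := aug
    aug_single := haug
    ker_aug := hker
    range_zero := hr S
    finite_of_fg := fun i h => hfg (seq i) (by rwa [← hr (seq i)]) }⟩

namespace MinimalResolution

variable {G : ConnectedGrading ε} (r : MinimalResolution G)

/-- Minimality: the differentials have entries in A₊ and hence vanish after tensoring with k. -/
theorem range_le : ∀ i, LinearMap.range (r.d i) ≤ RingHom.ker ε • ⊤
  | 0 => (r.range_zero.trans r.ker_aug).le
  | i + 1 => (r.range_succ i).trans_le (r.ker_le i)

theorem aug_surjective : Function.Surjective r.aug := fun x =>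
  ⟨Finsupp.single r.unique_zero.default (algebraMap k A x), by
    rw [r.aug_single]; exact ε.commutes x⟩

theorem isInternal (i : ℕ) :
    DirectSum.IsInternal fun j : ℤ => ((G.free (r.δ i)).piece j).toAddSubgroup := by
  classical
  let F := G.free (r.δ i)
  constructor
  · rw [injective_iff_map_eq_zero]
    intro x hx
    have key : ∀ y : ⨁ j : ℤ, (F.piece j).toAddSubgroup, ∀ m : ℤ,
        F.proj m (DirectSum.coeAddMonoidHom (fun j : ℤ => (F.piece j).toAddSubgroup) y) = y m := by
      intro y m
      induction y using DirectSum.induction_on with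
      | zero => simp
      | of n z =>
        rw [DirectSum.coeAddMonoidHom_of]
        by_cases hnm : n = m
        · subst hnm
          rw [DirectSum.of_eq_same]
          exact F.proj_of_mem _ _ z.2
        · rw [DirectSum.of_eq_of_ne _ _ _ (Ne.symm hnm), F.proj_of_ne _ _ _ z.2 hnm]
          rfl
      | add x y hx hy => rw [map_add, map_add, hx, hy]; rfl
    ext m
    have := key x m
    rw [hx, map_zero] at this
    rw [← this]; rfl
  · intro x
    obtain ⟨s, hs⟩ := F.exists_sum x
    refine ⟨∑ n ∈ s, DirectSum.of (fun j : ℤ => (F.piece j).toAddSubgroup) n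
      ⟨F.proj n x, F.proj_mem n x⟩, ?_⟩
    rw [map_sum]
    exact (Finset.sum_congr rfl fun n _ => DirectSum.coeAddMonoidHom_of _ _ _).trans hs

/-- A minimal resolution as a graded projective resolution. -/
noncomputable def toGradedResolution (𝒜 : ℕ → Submodule k A)
    (h𝒜 : ∀ n : ℕ, 𝒜 n ≤ G.piece n) : GradedResolution 𝒜 ε where
  P i := r.ι i →₀ A
  projective i := inferInstance
  deg i j := ((G.free (r.δ i)).piece j).toAddSubgroup
  isInternal := r.isInternal
  smul_mem i m j a ha x hx := G.smul_mem_free (r.δ i) (h𝒜 m ha) hx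
  d := r.d
  d_mem i j x hx := r.d_mem i j x hx
  aug := r.aug
  aug_eq_zero j hj x hx := by
    have hx' := hx
    rw [← LinearMap.mem_ker, r.ker_aug, ConnectedGrading.mem_aug_smul_top]
    intro b
    refine G.aug_eq_zero _ _ (hx b) ?_
    rwa [r.δ_zero, sub_zero]
  aug_surjective := r.aug_surjective
  exact_zero x := by rw [← LinearMap.mem_ker, ← r.range_zero]; rfl
  exact_succ i x := by rw [← LinearMap.mem_ker, ← r.range_succ]; rfl

/-- If `Tor_{i+1}(k, k)` is concentrated in degree `n`, then so are the generators of the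
corresponding term of a minimal resolution. -/
theorem δ_eq_of_tor (𝒜 : ℕ → Submodule k A) (h𝒜 : ∀ n : ℕ, 𝒜 n ≤ G.piece n) (i : ℕ) (n : ℤ)
    (h : ∀ j ≠ n, Subsingleton ((r.toGradedResolution 𝒜 h𝒜).Tor (i + 1) j)) (b : r.ι (i + 1)) :
    r.δ (i + 1) b = n := by
  by_contra hb
  let P := r.toGradedResolution 𝒜 h𝒜
  -- The complex k ⊗ P has zero differential, so Tor is k ⊗ P itself and every generator survives in
  -- it, in its own degree.
  have hd : ∀ i x, P.dQ i x = 0 := by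
    intro i x
    obtain ⟨x, rfl⟩ := Submodule.Quotient.mk_surjective _ x
    exact (Submodule.Quotient.mk_eq_zero _).2 (r.range_le i ⟨x, rfl⟩)
  let x : r.ι (i + 1) →₀ A := Finsupp.single b 1
  let y : P.Q (i + 1) := Submodule.Quotient.mk x
  have hx : x ∈ (G.free (r.δ (i + 1))).piece (r.δ (i + 1) b) :=
    G.single_mem_free _ G.one_mem (zero_add _)
  have hy : y ∈ P.cycles (i + 1) (r.δ (i + 1) b) := ⟨⟨x, hx, rfl⟩, AddMonoidHom.mem_ker.2 (hd i y)⟩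
  have hs : Subsingleton (P.cycles (i + 1) (r.δ (i + 1) b) ⧸
    (P.boundaries (i + 1) (r.δ (i + 1) b)).addSubgroupOf (P.cycles (i + 1) (r.δ (i + 1) b))) :=
    h _ hb
  have h0 := hs.elim (QuotientAddGroup.mk ⟨y, hy⟩) (QuotientAddGroup.mk 0)
  rw [QuotientAddGroup.eq] at h0
  obtain ⟨z, -, hz⟩ := AddSubgroup.mem_addSubgroupOf.1 h0
  have hz' : (0 : P.Q (i + 1)) = -y := by
    rw [← hd (i + 1) z]
    refine hz.trans ?_
    simp
  have h1 : y = 0 := by rw [← neg_eq_zero, ← hz']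
  have h2 := ConnectedGrading.mem_aug_smul_top.1 ((Submodule.Quotient.mk_eq_zero _).1 h1) b
  rw [Finsupp.single_eq_same, map_one] at h2
  exact one_ne_zero h2

end MinimalResolution

end MinimalResolution

/-! ### The grading of a homogeneous algebra -/

namespace HomogeneousAlgebra

variable {k : Type u} [Field k] {V : Type u} [AddCommGroup V] [Module k V] {N : ℕ}
  (R : Submodule k (⨂[k]^N V))

/-- The projection of the tensor algebra onto the homogeneous algebra. -/
abbrev proj : TensorAlgebra k V →ₐ[k] HomogeneousAlgebra R :=
  Ideal.Quotient.mkₐ k (relationIdeal R).asIdeal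

theorem proj_surjective : Function.Surjective (proj R) :=
  Ideal.Quotient.mkₐ_surjective _ _

theorem proj_eq_zero {t : TensorAlgebra k V} : proj R t = 0 ↔ t ∈ relationIdeal R := by
  rw [← TwoSidedIdeal.mem_asIdeal]
  exact Ideal.Quotient.eq_zero_iff_mem

theorem proj_relation {t : ⨂[k]^N V} (ht : t ∈ R) :
    proj R (TensorPower.toTensorAlgebra t) = 0 :=
  (proj_eq_zero R).2 (TwoSidedIdeal.subset_span ⟨t, ht, rfl⟩)

open Polynomial in
/-- The coaction `v ↦ v X` on the tensor algebra. -/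
noncomputable def tensorCoaction : TensorAlgebra k V →ₐ[k] (HomogeneousAlgebra R)[X] :=
  TensorAlgebra.lift k
    ((Polynomial.monomial (R := HomogeneousAlgebra R) 1).restrictScalars k ∘ₗ
      (proj R).toLinearMap ∘ₗ TensorAlgebra.ι k)

theorem tensorCoaction_ι (v : V) : tensorCoaction R (TensorAlgebra.ι k v) =
    Polynomial.monomial 1 (proj R (TensorAlgebra.ι k v)) := by
  simp [tensorCoaction]

theorem tensorCoaction_toTensorAlgebra (n : ℕ) (t : ⨂[k]^n V) :
    tensorCoaction R (TensorPower.toTensorAlgebra t) =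
      Polynomial.monomial n (proj R (TensorPower.toTensorAlgebra t)) := by
  have hl : ∀ l : List V, tensorCoaction R (l.map (TensorAlgebra.ι k)).prod =
      Polynomial.monomial l.length (proj R (l.map (TensorAlgebra.ι k)).prod) := by
    intro l
    induction l with
    | nil => simp
    | cons v l ih =>
      rw [List.map_cons, List.prod_cons, map_mul, map_mul, ih, tensorCoaction_ι,
        Polynomial.monomial_mul_monomial, List.length_cons, add_comm]
  induction t using PiTensorProduct.induction_on with
  | smul_tprod r f =>
    rw [map_smul, map_smul, map_smul, TensorPower.toTensorAlgebra_tprod, TensorAlgebra.tprod_apply]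
    have := hl (List.ofFn f)
    rw [List.map_ofFn, List.length_ofFn] at this
    change r • tensorCoaction R (List.ofFn (TensorAlgebra.ι k ∘ f)).prod = _
    rw [this, Polynomial.smul_monomial]
    rfl
  | add x y hx hy => simp only [map_add, hx, hy]

/-- The relations are homogeneous of degree N: each is sent to its class, which is zero, times X^N.
-/
theorem tensorCoaction_eq_zero (t : TensorAlgebra k V) (ht : t ∈ (relationIdeal R).asIdeal) :
    tensorCoaction R t = 0 := by
  have key : relationIdeal R ≤ TwoSidedIdeal.ker (tensorCoaction R) := by
    refine TwoSidedIdeal.span_le.2 ?_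
    rintro _ ⟨t, ht, rfl⟩
    rw [SetLike.mem_coe, TwoSidedIdeal.mem_ker, tensorCoaction_toTensorAlgebra,
      proj_relation R ht, map_zero]
  have h := key (TwoSidedIdeal.mem_asIdeal.1 ht)
  rwa [TwoSidedIdeal.mem_ker] at h

open Polynomial in
/-- The coaction of `k[X]` which encodes the grading of a homogeneous algebra. -/
noncomputable def coaction : HomogeneousAlgebra R →ₐ[k] (HomogeneousAlgebra R)[X] :=
  Ideal.Quotient.liftₐ (relationIdeal R).asIdeal (tensorCoaction R) (tensorCoaction_eq_zero R)

theorem coaction_of_mem {n : ℕ} {a : HomogeneousAlgebra R} (ha : a ∈ component R n) :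
    coaction R a = Polynomial.monomial n a := by
  obtain ⟨_, ⟨t, rfl⟩, rfl⟩ := ha
  exact tensorCoaction_toTensorAlgebra R n t

theorem mul_mem_component {m n : ℕ} {a b : HomogeneousAlgebra R} (ha : a ∈ component R m)
    (hb : b ∈ component R n) : a * b ∈ component R (m + n) := by
  obtain ⟨_, ⟨s, rfl⟩, rfl⟩ := ha
  obtain ⟨_, ⟨t, rfl⟩, rfl⟩ := hb
  refine ⟨_, ⟨@GradedMonoid.GMul.mul ℕ (fun i => ⨂[k]^i V) _ _ m n s t, rfl⟩, ?_⟩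
  rw [TensorPower.toTensorAlgebra_gMul]
  exact map_mul (proj R) _ _

theorem one_mem_component : (1 : HomogeneousAlgebra R) ∈ component R 0 :=
  ⟨_, ⟨_, TensorPower.toTensorAlgebra_gOne⟩, map_one (proj R)⟩

theorem ι_mem_component (v : V) : proj R (TensorAlgebra.ι k v) ∈ component R 1 :=
  ⟨_, ⟨PiTensorProduct.tprod k (fun _ => v), by
    rw [TensorPower.toTensorAlgebra_tprod, TensorAlgebra.tprod_apply]; simp⟩, rfl⟩

theorem coeff_coaction_mem (a : HomogeneousAlgebra R) (n : ℕ) :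
    (coaction R a).coeff n ∈ component R n := by
  obtain ⟨t, rfl⟩ := proj_surjective R a
  induction t using TensorAlgebra.induction generalizing n with
  | algebraMap r =>
    rw [AlgHom.commutes, AlgHom.commutes, Polynomial.algebraMap_apply, Polynomial.coeff_C]
    split_ifs with h
    · subst h
      rw [Algebra.algebraMap_eq_smul_one]
      exact Submodule.smul_mem _ _ (one_mem_component R)
    · exact zero_mem _
  | ι v =>
    rw [coaction_of_mem R (ι_mem_component R v), Polynomial.coeff_monomial]
    split_ifs with h
    · subst h; exact ι_mem_component R v
    · exact zero_mem _
  | mul x y hx hy =>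
    rw [map_mul, map_mul, Polynomial.coeff_mul]
    refine Submodule.sum_mem _ fun p hp => ?_
    rw [Finset.HasAntidiagonal.mem_antidiagonal] at hp
    rw [← hp]
    exact mul_mem_component R (hx _) (hy _)
  | add x y hx hy =>
    rw [map_add, map_add, Polynomial.coeff_add]
    exact add_mem (hx _) (hy _)

/-- Setting X = 1 in the coaction gives the identity, as can be checked on generators. Evaluation at
1 is multiplicative although A is not commutative, since 1 is central. -/
theorem sum_coeff_coaction (a : HomogeneousAlgebra R) :
    ∑ n ∈ (coaction R a).support, (coaction R a).coeff n = a := by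
  let e : Polynomial (HomogeneousAlgebra R) →+* HomogeneousAlgebra R :=
    Polynomial.eval₂RingHom' (RingHom.id _) 1 fun a => Commute.one_right a
  have he : ∀ n a, e (Polynomial.monomial n a) = a := fun n a => by
    change Polynomial.eval₂ _ _ _ = _
    rw [Polynomial.eval₂_monomial, one_pow, mul_one]; rfl
  have h : e (coaction R a) = a := by
    obtain ⟨t, rfl⟩ := proj_surjective R a
    induction t using TensorAlgebra.induction with
    | algebraMap r =>
      rw [AlgHom.commutes, AlgHom.commutes, Polynomial.algebraMap_apply]
      exact he 0 _
    | ι v => rw [coaction_of_mem R (ι_mem_component R v), he]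
    | mul x y hx hy => rw [map_mul, map_mul, map_mul, hx, hy]
    | add x y hx hy => rw [map_add, map_add, map_add, hx, hy]
  conv_rhs => rw [← h, ← Polynomial.sum_monomial_eq (coaction R a), Polynomial.sum, map_sum]
  simp only [he]

theorem mem_component_zero [N.AtLeastTwo] {a : HomogeneousAlgebra R} (ha : a ∈ component R 0) :
    a = algebraMap k _ (augmentation R a) := by
  obtain ⟨_, ⟨t, rfl⟩, rfl⟩ := ha
  have : ∃ r : k, TensorPower.toTensorAlgebra t = algebraMap k (TensorAlgebra k V) r := by
    induction t using PiTensorProduct.induction_on with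
    | smul_tprod r f =>
      refine ⟨r, ?_⟩
      rw [map_smul, TensorPower.toTensorAlgebra_tprod, TensorAlgebra.tprod_apply]
      simp [Algebra.algebraMap_eq_smul_one]
    | add x y hx hy =>
      obtain ⟨r, hr⟩ := hx
      obtain ⟨s, hs⟩ := hy
      exact ⟨r + s, by rw [map_add, map_add, hr, hs]⟩
  obtain ⟨r, hr⟩ := this
  rw [hr]
  change proj R _ = algebraMap k _ (augmentation R (proj R _))
  rw [AlgHom.commutes, AlgHom.commutes]
  rfl

theorem augmentation_proj [N.AtLeastTwo] (t : TensorAlgebra k V) :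
    augmentation R (proj R t) = TensorAlgebra.algebraMapInv t := rfl

theorem augmentation_of_mem [N.AtLeastTwo] {n : ℕ} (hn : n ≠ 0) {a : HomogeneousAlgebra R}
    (ha : a ∈ component R n) : augmentation R a = 0 := by
  obtain ⟨_, ⟨t, rfl⟩, rfl⟩ := ha
  change TensorAlgebra.algebraMapInv (TensorPower.toTensorAlgebra t) = 0
  induction t using PiTensorProduct.induction_on with
  | smul_tprod r f =>
    rw [map_smul, map_smul, TensorPower.toTensorAlgebra_tprod, TensorAlgebra.tprod_apply,
      map_list_prod, List.prod_eq_zero, smul_zero]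
    rw [List.map_ofFn, List.mem_ofFn]
    exact ⟨⟨0, Nat.pos_of_ne_zero hn⟩, by simp [TensorAlgebra.algebraMapInv]⟩
  | add x y hx hy => rw [map_add, map_add, hx, hy, add_zero]

/-- The grading of a homogeneous algebra. -/
noncomputable def grading [N.AtLeastTwo] [Module.Finite k V] :
    ConnectedGrading (augmentation R) where
  piece
    | .ofNat n => component R n
    | .negSucc _ => ⊥
  proj
    | .ofNat n => (Polynomial.lcoeff (HomogeneousAlgebra R) n).restrictScalars k ∘ₗ
        (coaction R).toLinearMap
    | .negSucc _ => 0
  proj_mem n a := by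
    rcases n with n | n
    · exact coeff_coaction_mem R a n
    · exact zero_mem _
  proj_of_mem n a ha := by
    rcases n with n | n
    · change (coaction R a).coeff n = a
      rw [coaction_of_mem R ha, Polynomial.coeff_monomial_same]
    · exact ((Submodule.mem_bot k).1 ha).symm
  proj_of_ne m n a ha hmn := by
    rcases n with n | n
    · rcases m with m | m
      · change (coaction R a).coeff n = 0
        rw [coaction_of_mem R ha, Polynomial.coeff_monomial_of_ne]
        rintro rfl; exact hmn rfl
      · rw [(Submodule.mem_bot k).1 ha, map_zero]
    · rfl
  exists_sum a := by
    refine ⟨(coaction R a).support.map Nat.castEmbedding, ?_⟩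
    rw [Finset.sum_map]
    exact sum_coeff_coaction R a
  mul_mem m n a b ha hb := by
    rcases m with m | m
    · rcases n with n | n
      · exact mul_mem_component R ha hb
      · rw [(Submodule.mem_bot k).1 hb, mul_zero]; exact zero_mem _
    · rw [(Submodule.mem_bot k).1 ha, zero_mul]; exact zero_mem _
  eq_bot n hn := by
    rcases n with n | n
    · exact absurd hn (by simp)
    · rfl
  finite n := by
    rcases n with n | n
    · change Module.Finite k (component R n)
      unfold component
      infer_instance
    · change Module.Finite k (⊥ : Submodule k (HomogeneousAlgebra R))
      infer_instance
  one_mem := one_mem_component R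
  mem_zero a ha := mem_component_zero R ha
  aug_eq_zero n a ha hn := by
    rcases n with n | n
    · exact augmentation_of_mem R (by rintro rfl; exact hn rfl) ha
    · rw [(Submodule.mem_bot k).1 ha, map_zero]

theorem component_le_grading [N.AtLeastTwo] [Module.Finite k V] (n : ℕ) :
    component R n ≤ (grading R).piece n := le_rfl

end HomogeneousAlgebra

/-! ### Finite presentation of the augmentation ideal -/

namespace HomogeneousAlgebra

section TensorAlgebra

variable {k : Type u} [Field k] {V : Type u} [AddCommGroup V] [Module k V]
  {J : Type u} (b : Module.Basis J k V)

/-- A vector of `V`, as an element of the free module over the tensor algebra on a basis of `V`. -/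
noncomputable def freeVector : V →ₗ[k] (J →₀ TensorAlgebra k V) :=
  Finsupp.mapRange.linearMap (Algebra.linearMap k (TensorAlgebra k V)) ∘ₗ b.repr.toLinearMap

/-- The tensor algebra acts on `k ⊕ (T ⊗ V)`, identified with itself through `T = k ⊕ T ⊗ V`. -/
noncomputable def splitAction : TensorAlgebra k V →ₐ[k]
    Module.End k (k × (J →₀ TensorAlgebra k V)) :=
  TensorAlgebra.lift k
    { toFun := fun v => LinearMap.inr k k (J →₀ TensorAlgebra k V) ∘ₗ
        (LinearMap.coprod (LinearMap.toSpanSingleton k _ (freeVector b v))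
          (DistribSMul.toLinearMap k (J →₀ TensorAlgebra k V) (TensorAlgebra.ι k v)))
      map_add' := fun v w => by
        ext x <;> simp [add_smul]
      map_smul' := fun c v => by
        ext x <;> simp [smul_comm] }

theorem splitAction_ι (v : V) (c : k) (w : J →₀ TensorAlgebra k V) :
    splitAction b (TensorAlgebra.ι k v) (c, w) =
      (0, c • freeVector b v + TensorAlgebra.ι k v • w) := by
  simp [splitAction]

theorem splitAction_inr (t : TensorAlgebra k V) (w : J →₀ TensorAlgebra k V) :
    splitAction b t (0, w) = (0, t • w) := by
  induction t using TensorAlgebra.induction generalizing w with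
  | algebraMap r =>
    rw [AlgHom.commutes, Module.algebraMap_end_apply, algebraMap_smul, Prod.smul_mk, smul_zero]
  | ι v => rw [splitAction_ι, zero_smul, zero_add]
  | mul x y hx hy => rw [map_mul, Module.End.mul_apply, hy, hx, mul_smul]
  | add x y hx hy => rw [map_add, LinearMap.add_apply, hx, hy, add_smul, Prod.mk_add_mk, add_zero]

/-- The component in `T ⊗ V` of an element of `T = k ⊕ T ⊗ V`. -/
noncomputable def rightParts : TensorAlgebra k V →ₗ[k] (J →₀ TensorAlgebra k V) :=
  LinearMap.snd k k _ ∘ₗ LinearMap.applyₗ (1, 0) ∘ₗ (splitAction b).toLinearMap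

theorem splitAction_one (t : TensorAlgebra k V) :
    splitAction b t (1, 0) = (TensorAlgebra.algebraMapInv t, rightParts b t) := by
  refine Prod.ext ?_ rfl
  induction t using TensorAlgebra.induction with
  | algebraMap r =>
    rw [AlgHom.commutes, Module.algebraMap_end_apply]
    simp
  | ι v => rw [splitAction_ι]; simp [TensorAlgebra.algebraMapInv]
  | mul x y hx hy =>
    rw [map_mul, Module.End.mul_apply]
    have hy' : splitAction b y (1, 0) =
        TensorAlgebra.algebraMapInv y • (1, 0) + (0, rightParts b y) := by
      refine Prod.ext ?_ ?_
      · rw [hy]; simp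
      · simp [rightParts]
    rw [hy', map_add, map_smul, splitAction_inr, Prod.fst_add, Prod.smul_fst, hx, add_zero,
      map_mul, smul_eq_mul, mul_comm]
  | add x y hx hy => rw [map_add, LinearMap.add_apply, Prod.fst_add, hx, hy, map_add]

/-- If t = ε(t) + ∑ t_j b_j, then st = ε(t)s + ∑ (s t_j) b_j. This twisted Leibniz rule makes it
possible to follow a two-sided ideal through `rightParts`. -/
theorem rightParts_mul (s t : TensorAlgebra k V) :
    rightParts b (s * t) =
      TensorAlgebra.algebraMapInv t • rightParts b s + s • rightParts b t := by
  have h : splitAction b (s * t) (1, 0) =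
      TensorAlgebra.algebraMapInv t • splitAction b s (1, 0) +
        splitAction b s (0, rightParts b t) := by
    rw [map_mul, Module.End.mul_apply, splitAction_one, ← map_smul, ← map_add]
    simp
  rw [splitAction_one, splitAction_one, splitAction_inr] at h
  exact congrArg Prod.snd h

theorem rightParts_ι (v : V) : rightParts b (TensorAlgebra.ι k v) = freeVector b v := by
  have := splitAction_ι b v 1 0
  rw [splitAction_one, one_smul, smul_zero, add_zero] at this
  exact congrArg Prod.snd this

/-- The multiplication `T ⊗ V → T`. -/
noncomputable def combine : (J →₀ TensorAlgebra k V) →ₗ[TensorAlgebra k V] TensorAlgebra k V :=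
  Finsupp.linearCombination _ fun j => TensorAlgebra.ι k (b j)

/-- Together with `combine_rightParts` this says that T₊ is a free left T-module on a basis of V. -/
theorem rightParts_combine (w : J →₀ TensorAlgebra k V) : rightParts b (combine b w) = w := by
  induction w using Finsupp.induction_linear with
  | zero => rw [map_zero, map_zero]
  | add f g hf hg => rw [map_add, map_add, hf, hg]
  | single j t =>
    rw [combine, Finsupp.linearCombination_single, smul_eq_mul, rightParts_mul, rightParts_ι]
    simp [TensorAlgebra.algebraMapInv, freeVector]

theorem combine_rightParts [Fintype J] (t : TensorAlgebra k V) :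
    combine b (rightParts b t) = t - algebraMap k _ (TensorAlgebra.algebraMapInv t) := by
  induction t using TensorAlgebra.induction with
  | algebraMap r =>
    have : rightParts b (algebraMap k (TensorAlgebra k V) r) = 0 := by
      have := splitAction_one b (algebraMap k _ r)
      rw [AlgHom.commutes, Module.algebraMap_end_apply] at this
      simpa using (congrArg Prod.snd this).symm
    rw [this, map_zero]
    simp
  | ι v =>
    rw [rightParts_ι]
    have : combine b (freeVector b v) = TensorAlgebra.ι k v := by
      conv_rhs => rw [← b.sum_repr v, map_sum]
      rw [combine, Finsupp.linearCombination_apply, Finsupp.sum_fintype _ _ (by simp)]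
      simp [freeVector, Algebra.smul_def]
    rw [this]
    simp [TensorAlgebra.algebraMapInv]
  | mul x y hx hy =>
    rw [rightParts_mul,
      ← algebraMap_smul (TensorAlgebra k V) (TensorAlgebra.algebraMapInv y) (rightParts b x),
      map_add, map_smul, map_smul, hx, hy, smul_eq_mul, smul_eq_mul, map_mul, mul_sub, mul_sub,
      Algebra.commutes _ x, mul_comm (TensorAlgebra.algebraMapInv x), map_mul]
    abel
  | add x y hx hy => rw [map_add, map_add, hx, hy, map_add, map_add]; abel

end TensorAlgebra

variable {k : Type u} [Field k] {V : Type u} [AddCommGroup V] [Module k V] {N : ℕ}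
  (R : Submodule k (⨂[k]^N V))

/-- The augmentation ideal of a homogeneous algebra is finitely presented. -/
theorem finitePresentation_ker_augmentation [N.AtLeastTwo] [Module.Finite k V] :
    Module.FinitePresentation (HomogeneousAlgebra R)
      (RingHom.ker (augmentation R) : Ideal (HomogeneousAlgebra R)) := by
  classical
  let A := HomogeneousAlgebra R
  let T := TensorAlgebra k V
  let J := Module.Free.ChooseBasisIndex k V
  let b : Module.Basis J k V := Module.Free.chooseBasis k V
  let l₀ : (J →₀ A) →ₗ[A] A := Finsupp.linearCombination A fun j => proj R (TensorAlgebra.ι k (b j))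
  let p : (J →₀ T) →ₗ[k] (J →₀ A) := Finsupp.mapRange.linearMap (proj R).toLinearMap
  have hp : ∀ (t : T) w, p (t • w) = proj R t • p w := fun t w => by
    ext j
    simp only [p, Finsupp.mapRange.linearMap_apply, Finsupp.mapRange_apply, Finsupp.smul_apply,
      smul_eq_mul]
    exact map_mul (proj R) _ _
  have hps : Function.Surjective p :=
    Finsupp.mapRange_surjective _ (map_zero _) (proj_surjective R)
  have hlp : ∀ w, l₀ (p w) = proj R (combine b w) := fun w => by
    induction w using Finsupp.induction_linear with
    | zero => simp only [map_zero]
    | add f g hf hg => simp only [map_add, hf, hg]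
    | single j t =>
      have : p (Finsupp.single j t) = Finsupp.single j (proj R t) :=
        Finsupp.mapRange_single (hf := map_zero _)
      rw [this]
      simp only [l₀, combine, Finsupp.linearCombination_single, smul_eq_mul]
      exact (map_mul (proj R) _ _).symm
  have hl₀ : ∀ f, l₀ f ∈ (RingHom.ker (augmentation R) : Ideal A) := fun f => by
    obtain ⟨w, rfl⟩ := hps f
    rw [hlp]
    change augmentation R _ = 0
    rw [augmentation_proj]
    -- Comparing this with `combine_rightParts` shows that the constant term of `combine b w` is
    -- zero.
    have h := congrArg (combine b) (rightParts_combine b w)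
    rw [combine_rightParts] at h
    have h2 : algebraMap k T (TensorAlgebra.algebraMapInv (combine b w)) = 0 := by
      simpa using h
    have h3 := congrArg TensorAlgebra.algebraMapInv h2
    rwa [TensorAlgebra.algebraMap_leftInverse, map_zero] at h3
  let l : (J →₀ A) →ₗ[A] (RingHom.ker (augmentation R) : Ideal A) := l₀.codRestrict _ hl₀
  refine Module.finitePresentation_of_surjective l ?_ ?_
  · rintro ⟨a, ha⟩
    obtain ⟨t, rfl⟩ := proj_surjective R a
    refine ⟨p (rightParts b t), Subtype.ext ?_⟩
    change l₀ _ = _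
    have ha' : TensorAlgebra.algebraMapInv t = 0 := ha
    rw [hlp, combine_rightParts, ha', map_zero, sub_zero]
  -- The kernel of A ⊗ V → A₊ is generated, as a left module, by the images of R. An element of it
  -- lifts to some `w` with `combine b w` in I(R), and one argues by induction on membership in the
  -- two-sided ideal.
  · have key : LinearMap.ker l = Submodule.span A
        ((fun r => p (rightParts b (TensorPower.toTensorAlgebra r))) '' (R : Set (⨂[k]^N V))) := by
      refine le_antisymm ?_ (Submodule.span_le.2 ?_)
      · intro f hf
        obtain ⟨w, rfl⟩ := hps f
        have h0 : l₀ (p w) = 0 := congrArg Subtype.val hf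
        rw [hlp, proj_eq_zero] at h0
        rw [← rightParts_combine b w]
        generalize combine b w = y at h0
        induction h0 using TwoSidedIdeal.span_induction with
        | mem x h =>
          obtain ⟨r, hr, rfl⟩ := h
          exact Submodule.subset_span ⟨r, hr, rfl⟩
        | zero => rw [map_zero, map_zero]; exact zero_mem _
        | add x y _ _ hx hy => rw [map_add, map_add]; exact add_mem hx hy
        | neg x _ hx => rw [map_neg, map_neg]; exact neg_mem hx
        | left_absorb t x hx h =>
          rw [rightParts_mul, algebraMapInv_eq_zero R x (TwoSidedIdeal.mem_asIdeal.2 hx), zero_smul,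
            zero_add, hp]
          exact Submodule.smul_mem _ _ h
        -- For xt with x in I(R), the Leibniz rule gives ε(t) times the parts of x, plus x times the
        -- parts of t; the second term dies in A.
        | right_absorb t x hx h =>
          rw [rightParts_mul, map_add, map_smul, hp, (proj_eq_zero R).2 hx, zero_smul, add_zero,
            ← algebraMap_smul A]
          exact Submodule.smul_mem _ _ h
      · rintro _ ⟨r, hr, rfl⟩
        refine Subtype.ext ?_
        change l₀ _ = 0
        have hmem : TensorPower.toTensorAlgebra r ∈ relationIdeal R :=
          TwoSidedIdeal.subset_span ⟨r, hr, rfl⟩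
        rw [hlp, combine_rightParts,
          algebraMapInv_eq_zero R _ (TwoSidedIdeal.mem_asIdeal.2 hmem), map_zero, sub_zero,
          proj_relation R hr]
    rw [key]
    obtain ⟨s, hs⟩ : R.FG := Module.Finite.iff_fg.1 inferInstance
    let D : (⨂[k]^N V) →ₗ[k] (J →₀ A) :=
      p ∘ₗ rightParts b ∘ₗ TensorPower.toTensorAlgebra
    refine ⟨s.image D, le_antisymm (Submodule.span_mono ?_) (Submodule.span_le.2 ?_)⟩
    · rw [Finset.coe_image]
      refine Set.image_mono ?_
      rw [← hs]; exact Submodule.subset_span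
    · rintro _ ⟨r, hr, rfl⟩
      have : R ≤ ((Submodule.span A (s.image D : Set (J →₀ A))).restrictScalars k).comap D := by
        refine hs.symm.le.trans (Submodule.span_le.2 fun x hx => ?_)
        exact Submodule.subset_span (Finset.mem_coe.2 (Finset.mem_image_of_mem D hx))
      exact this hr

end HomogeneousAlgebra

theorem MinimalResolution.finitePresentation_range_zero {k : Type u} [Field k] {A : Type u} [Ring A]
    [Algebra k A] {ε : A →ₐ[k] k} {G : ConnectedGrading ε} (r : MinimalResolution G)
    (h : Module.FinitePresentation A (RingHom.ker ε : Ideal A)) :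
    Module.FinitePresentation A (LinearMap.range (r.d 0)) := by
  have := r.unique_zero
  let e : (r.ι 0 →₀ A) ≃ₗ[A] A := Finsupp.uniqueLinearEquiv A A (default : r.ι 0)
  suffices h' : Submodule.map e.symm.toLinearMap (RingHom.ker ε : Ideal A) = LinearMap.range (r.d 0) by
    let e' : (RingHom.ker ε : Ideal A) ≃ₗ[A] LinearMap.range (r.d 0) :=
      LinearEquiv.ofSubmodules e.symm _ _ h'
    exact Module.FinitePresentation.of_equiv (R := A) (M := (RingHom.ker ε : Ideal A))
      (N := LinearMap.range (r.d 0)) e'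
  rw [r.range_zero, r.ker_aug]
  ext f
  rw [ConnectedGrading.mem_aug_smul_top]
  constructor
  · rintro ⟨a, ha, rfl⟩ b
    have : e.symm a b = a := by
      rw [Subsingleton.elim b default]
      simp [e]
    exact (congrArg ε this).trans ha
  · intro hf
    exact ⟨e f, hf default, e.symm_apply_apply f⟩

/-- The trivial module of a Koszul homogeneous algebra has a minimal graded resolution by finitely
generated free modules. -/
theorem HomogeneousAlgebra.IsKoszul.exists_finite_minimalResolution {k : Type u} [Field k]
    {V : Type u} [AddCommGroup V] [Module k V] {N : ℕ} {R : Submodule k (⨂[k]^N V)}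
    [N.AtLeastTwo] [Module.Finite k V] (hK : HomogeneousAlgebra.IsKoszul R) :
    ∃ r : MinimalResolution (grading R), ∀ i, Finite (r.ι i) := by
  obtain ⟨r⟩ := exists_minimalResolution (grading R)
  have hfp := r.finitePresentation_range_zero (finitePresentation_ker_augmentation R)
  have h1 : Finite (r.ι 1) := r.finite_of_fg 0 (Module.Finite.iff_fg.1 inferInstance)
  refine ⟨r, fun i => ?_⟩
  match i with
  | 0 => exact @Finite.of_subsingleton _ (@Unique.instSubsingleton _ r.unique_zero)
  | 1 => exact h1
  -- The second term covers the kernel of P_1 → A₊, finitely generated because A₊ is finitely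
  -- presented.
  | 2 =>
    refine r.finite_of_fg 1 ?_
    let l : (r.ι 1 →₀ HomogeneousAlgebra R) →ₗ[HomogeneousAlgebra R] LinearMap.range (r.d 0) :=
      (r.d 0).rangeRestrict
    have h2 : (LinearMap.ker l).FG :=
      Module.FinitePresentation.fg_ker (R := HomogeneousAlgebra R)
        (M := r.ι 1 →₀ HomogeneousAlgebra R) (N := LinearMap.range (r.d 0)) l
        (LinearMap.surjective_rangeRestrict (r.d 0))
    simp only [l] at h2
    rwa [LinearMap.ker_rangeRestrict, ← r.range_succ] at h2
  -- By the Koszul condition all generators lie in degree n(i + 3), and each degree contains only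
  -- finitely many.
  | i + 3 =>
    have h3 := r.δ_eq_of_tor (component R) (component_le_grading R) (i + 2) (jump N (i + 3))
      (hK _ _ (by lia))
    have h4 := r.finite_fiber (i + 3) (jump N (i + 3))
    rw [Set.eq_univ_of_forall (s := {b | r.δ (i + 3) b = jump N (i + 3)}) h3] at h4
    exact Set.finite_univ_iff.1 h4

/-! ### Syzygies and Ext with values in the trivial module -/

section Syzygies

variable {k : Type u} [Field k] {A : Type u} [Ring A] [Algebra k A] {ε : A →ₐ[k] k}

/-- The augmentation as a morphism of left `A`-modules. -/
noncomputable def augHom (ε : A →ₐ[k] k) : ModuleCat.of A A ⟶ trivialModule ε :=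
  ModuleCat.ofHom (LinearMap.toSpanSingleton A _ (TrivialModule.one ε))

theorem augHom_apply (a : A) : (augHom ε).hom a = (ε a : k) := TrivialModule.smul_one a

theorem map_aug_smul_top_eq_zero {M : Type u} [AddCommGroup M] [Module A M]
    (f : M →ₗ[A] TrivialModule ε) {x : M} (hx : x ∈ (RingHom.ker ε • ⊤ : Submodule A M)) :
    f x = 0 := by
  induction hx using Submodule.smul_induction_on' with
  | smul a ha z hz =>
    rw [map_smul, TrivialModule.smul_def, RingHom.mem_ker.1 ha]
    exact zero_mul (M₀ := k) _
  | add x _ y _ hx hy => rw [map_add, hx, hy, add_zero]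

theorem finite_ext_zero_free (ι : Type u) [Finite ι] :
    Module.Finite k (Ext (ModuleCat.of A (ι →₀ A)) (trivialModule ε) 0) := by
  let L : Ext (ModuleCat.of A (ι →₀ A)) (trivialModule ε) 0 →ₗ[k] (ι → k) :=
    { toFun := fun x b => ((Ext.linearEquiv₀ (R := k) x).hom (Finsupp.single b 1) : TrivialModule ε)
      map_add' := fun x y => by rw [map_add]; rfl
      map_smul' := fun c x => by
        rw [map_smul]
        funext b
        change algebraMap k A c • (_ : TrivialModule ε) = _
        rw [TrivialModule.smul_def, AlgHom.commutes]
        rfl }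
  refine Module.Finite.of_injective L fun x y hxy => ?_
  apply (Ext.linearEquiv₀ (R := k)).injective
  exact ModuleCat.hom_ext (Finsupp.lhom_ext' fun b => LinearMap.ext_ring (congrFun hxy b))

namespace MinimalResolution

variable {G : ConnectedGrading ε} (r : MinimalResolution G)

/-- The syzygies of the trivial module in a minimal resolution. -/
noncomputable def syzygy : ℕ → ModuleCat.{u} A
  | 0 => trivialModule ε
  | i + 1 => ModuleCat.of A (LinearMap.range (r.d i))

/-- The terms of a minimal resolution. -/
noncomputable abbrev term (i : ℕ) : ModuleCat.{u} A := ModuleCat.of A (r.ι i →₀ A)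

/-- The projection of a term of the resolution onto the syzygy which it covers. -/
noncomputable def cover : ∀ i, r.term i ⟶ r.syzygy i
  | 0 => ModuleCat.ofHom r.aug
  | i + 1 => ModuleCat.ofHom (r.d i).rangeRestrict

/-- The inclusion of a syzygy in a term of the resolution. -/
noncomputable def incl (i : ℕ) : r.syzygy (i + 1) ⟶ r.term i :=
  ModuleCat.ofHom (LinearMap.range (r.d i)).subtype

theorem cover_surjective : ∀ i, Function.Surjective (r.cover i)
  | 0 => r.aug_surjective
  | i + 1 => LinearMap.surjective_rangeRestrict (r.d i)

theorem exact_incl_cover : ∀ i, Function.Exact (r.incl i) (r.cover i)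
  | 0 => fun x => by
    change r.aug x = 0 ↔ x ∈ Set.range (Subtype.val : LinearMap.range (r.d 0) → _)
    rw [Subtype.range_coe, ← LinearMap.mem_ker, ← r.range_zero]
    rfl
  | i + 1 => fun x => by
    change (r.d i).rangeRestrict x = 0 ↔ x ∈ Set.range (Subtype.val : LinearMap.range (r.d (i + 1)) → _)
    rw [Subtype.range_coe, ← LinearMap.mem_ker, LinearMap.ker_rangeRestrict, ← r.range_succ]
    rfl

/-- The short exact sequence `0 → Ω^{i+1} → P_i → Ω^i → 0`. -/
noncomputable abbrev shortComplex (i : ℕ) : ShortComplex (ModuleCat.{u} A) :=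
  ShortComplex.mk (r.incl i) (r.cover i) (by
    ext x
    exact (r.exact_incl_cover i _).2 ⟨x, rfl⟩)

theorem shortExact (i : ℕ) : (r.shortComplex i).ShortExact :=
  ModuleCat.shortComplex_shortExact _ (r.exact_incl_cover i) Subtype.val_injective
    (r.cover_surjective i)

/-- Dimension shifting: Ext^{i+1}(Ω^l, k) is a quotient of Ext^i(Ω^{l+1}, k), and Hom(Ω^l, k) embeds
in Hom(P_l, k). -/
theorem finite_ext [∀ i, Finite (r.ι i)] (i l : ℕ) :
    Module.Finite k (Ext (r.syzygy l) (trivialModule ε) i) := by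
  induction i generalizing l with
  | zero =>
    have := finite_ext_zero_free (ε := ε) (r.ι l)
    have : Epi (r.cover l) := (r.shortExact l).epi_g
    exact Module.Finite.of_injective
      (extPrecomp k (Ext.mk₀ (r.cover l)) (trivialModule ε) (zero_add 0))
      (Ext.precomp_mk₀_injective_of_epi _ (r.cover l))
  | succ i ih =>
    have := ih (l + 1)
    refine Module.Finite.of_surjective
      (extPrecomp k (r.shortExact l).extClass (trivialModule ε) (add_comm 1 i)) fun x => ?_
    exact Ext.contravariant_sequence_exact₃ (r.shortExact l) _ x
      (Ext.eq_zero_of_projective (P := r.term l) _) (add_comm 1 i)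

/-- By minimality Ω^{l+1} lies in A₊P_l, which every homomorphism to k kills; in positive degrees
P_l has no Ext. -/
theorem incl_comp_eq_zero {i : ℕ} (l : ℕ) (x : Ext (r.term l) (trivialModule ε) i) :
    (Ext.mk₀ (r.incl l)).comp x (zero_add i) = 0 := by
  cases i with
  | zero =>
    obtain ⟨f, rfl⟩ := Ext.addEquiv₀.symm.surjective x
    rw [Ext.addEquiv₀_symm_apply, Ext.mk₀_comp_mk₀, Ext.mk₀_eq_zero_iff]
    ext z
    exact map_aug_smul_top_eq_zero (ε := ε) f.hom (r.range_le l z.2)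
  | succ i => rw [Ext.eq_zero_of_projective x, Ext.comp_zero]

/-- By `incl_comp_eq_zero` the connecting maps are injective, so the vanishing descends to Hom(Ω^i,
k) = 0. But the coordinate form of a generator of P_i kills Ω^{i+1} and hence factors through Ω^i:
there can be no generator. -/
theorem isEmpty_of_ext_eq_zero {i : ℕ}
    (h : ∀ x : Ext (trivialModule ε) (trivialModule ε) i, x = 0) : IsEmpty (r.ι i) := by
  have key : ∀ i l : ℕ, (∀ x : Ext (r.syzygy l) (trivialModule ε) i, x = 0) →
      ∀ m, m = l + i → ∀ x : Ext (r.syzygy m) (trivialModule ε) 0, x = 0 := by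
    intro i
    induction i with
    | zero => rintro l h _ rfl x; exact h x
    | succ i ih =>
      rintro l h m hm
      refine ih (l + 1) (fun x => ?_) m (by lia)
      obtain ⟨y, rfl⟩ := Ext.contravariant_sequence_exact₁ (r.shortExact l) _ x (add_comm 1 i)
        (h _)
      exact r.incl_comp_eq_zero l y
  have h0 := key i 0 h i (zero_add i).symm
  refine ⟨fun b => ?_⟩
  let g : r.term i ⟶ trivialModule ε := ModuleCat.ofHom (Finsupp.lapply b) ≫ augHom ε
  obtain ⟨x, hx⟩ := Ext.contravariant_sequence_exact₂ (r.shortExact i) _ (Ext.mk₀ g)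
    (r.incl_comp_eq_zero i _)
  rw [h0 x, Ext.comp_zero, eq_comm, Ext.mk₀_eq_zero_iff] at hx
  have h1 : g.hom (Finsupp.single b 1) = 0 := by rw [hx]; rfl
  have h2 : g.hom (Finsupp.single b 1) = (ε 1 : k) := by
    change (augHom ε).hom (Finsupp.single b (1 : A) b) = _
    rw [Finsupp.single_eq_same, augHom_apply]
  rw [h2, map_one] at h1
  exact one_ne_zero (α := k) h1

end MinimalResolution

/-! ### Truncations of A and separation of Ext classes -/

namespace ConnectedGrading

variable (G : ConnectedGrading ε)

/-- The left ideal of elements without homogeneous components of degree less than `n`. -/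
noncomputable def tail (n : ℤ) : Submodule A A where
  carrier := {a | ∀ m < n, G.proj m a = 0}
  add_mem' ha hb m hm := by rw [map_add, ha m hm, hb m hm, add_zero]
  zero_mem' m _ := map_zero _
  smul_mem' b a ha m hm := by
    obtain ⟨s, hs⟩ := G.exists_sum b
    rw [← hs, smul_eq_mul, Finset.sum_mul, map_sum]
    refine Finset.sum_eq_zero fun l _ => ?_
    rw [G.proj_mul (G.proj_mem l b)]
    rcases lt_or_ge l 0 with hl | hl
    · rw [G.proj_neg hl, zero_mul]
    · rw [ha _ (by lia), mul_zero]

/-- The projection of `A` onto its truncation in degrees less than `n`. -/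
noncomputable def truncation (n : ℤ) : ModuleCat.of A A ⟶ ModuleCat.of A (A ⧸ G.tail n) :=
  ModuleCat.ofHom (G.tail n).mkQ

theorem truncation_eq_zero {n : ℤ} {a : A} : (G.truncation n).hom a = 0 ↔ a ∈ G.tail n :=
  Submodule.Quotient.mk_eq_zero _

end ConnectedGrading

namespace MinimalResolution

variable {G : ConnectedGrading ε} (r : MinimalResolution G)

/-- A homomorphism from a syzygy to `A` extends to the ambient free module if it does so modulo
elements of arbitrarily large degree. -/
theorem exists_extension [∀ i, Finite (r.ι i)] (l : ℕ) (f : LinearMap.range (r.d l) →ₗ[A] A)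
    (h : ∀ n, ∃ g : (r.ι l →₀ A) →ₗ[A] A,
      ∀ z : LinearMap.range (r.d l), g z - f z ∈ G.tail n) :
    ∃ g : (r.ι l →₀ A) →ₗ[A] A, ∀ z : LinearMap.range (r.d l), g z = f z := by
  classical
  let e : r.ι (l + 1) → LinearMap.range (r.d l) := fun s => ⟨r.d l (Finsupp.single s 1), _, rfl⟩
  choose S hS _ using fun s => G.exists_support (f (e s))
  -- `c` bounds the degree by which `f` shifts the finitely many generators.
  obtain ⟨c, hc⟩ : ∃ c : ℤ, ∀ s, ∀ m, r.δ (l + 1) s + c < m → G.proj m (f (e s)) = 0 := by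
    have : ∀ s, ∃ c : ℤ, ∀ m ∈ S s, m ≤ c := fun s => (S s).bddAbove
    choose c hc using this
    obtain ⟨C, hC⟩ := (Set.finite_range c).bddAbove
    refine ⟨C, fun s m hm => hS s m fun hmS => ?_⟩
    have h1 := hc s m hmS
    have h2 : c s ≤ C := hC ⟨s, rfl⟩
    have h3 := r.δ_nonneg _ s
    lia
  obtain ⟨B, hB⟩ := (Set.finite_range (r.δ (l + 1))).bddAbove
  -- No `f (e s)` has a component of degree above B + c, so `g` is required to agree with `f` up to
  -- that degree.
  obtain ⟨g, hg⟩ := h (B + c + 1)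
  -- The part of `g` which shifts degrees by at most `c`.
  let g' : (r.ι l →₀ A) →ₗ[A] A := Finsupp.linearCombination A fun t =>
    ∑ p ∈ Finset.Icc 0 (r.δ l t + c), G.proj p (g (Finsupp.single t 1))
  have hproj : ∀ t p, G.proj p (∑ p ∈ Finset.Icc 0 (r.δ l t + c),
      G.proj p (g (Finsupp.single t 1))) =
      if p ≤ r.δ l t + c then G.proj p (g (Finsupp.single t 1)) else 0 := by
    intro t p
    rw [G.proj_sum]
    rcases lt_or_ge p 0 with hp | hp
    · rw [G.proj_neg hp]; simp
    · simp [Finset.mem_Icc, hp]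
  have hsum : ∀ (q : (r.ι l →₀ A) →ₗ[A] A) (w : r.ι l →₀ A),
      q w = w.sum fun t a => a * q (Finsupp.single t 1) := by
    intro q w
    conv_lhs => rw [← Finsupp.sum_single w, Finsupp.sum, map_sum]
    refine Finset.sum_congr rfl fun t _ => ?_
    dsimp only
    rw [← smul_eq_mul, ← map_smul, Finsupp.smul_single, smul_eq_mul, mul_one]
  have hw : ∀ s t, (e s : r.ι l →₀ A) t ∈ G.piece (r.δ (l + 1) s - r.δ l t) := fun s =>
    r.d_mem l _ _ (G.single_mem_free _ G.one_mem (zero_add _))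
  have hpr : ∀ (q : (r.ι l →₀ A) →ₗ[A] A) s m, G.proj m (q (e s)) =
      (e s : r.ι l →₀ A).sum fun t a =>
        a * G.proj (m - (r.δ (l + 1) s - r.δ l t)) (q (Finsupp.single t 1)) := by
    intro q s m
    rw [hsum, Finsupp.sum, map_sum]
    exact Finset.sum_congr rfl fun t _ => G.proj_mul (hw s t) _ _
  have hgs : ∀ t, g' (Finsupp.single t 1) = ∑ p ∈ Finset.Icc 0 (r.δ l t + c),
      G.proj p (g (Finsupp.single t 1)) := fun t => by simp [g']
  have key : ∀ s, g' (e s) = f (e s) := by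
    intro s
    refine G.ext_proj fun m => ?_
    rw [hpr]
    simp only [hgs, hproj]
    -- The differential preserves degrees, so the cutoff in `g'` translates exactly into this
    -- condition on `m`. Below it `g'` agrees with `g`, hence with `f`; above it both `g'` and `f`
    -- have no component.
    by_cases hm : m ≤ r.δ (l + 1) s + c
    · have h1 : G.proj m (g (e s)) = G.proj m (f (e s)) := by
        have h2 : r.δ (l + 1) s ≤ B := hB ⟨s, rfl⟩
        rw [← sub_eq_zero, ← map_sub]
        exact hg (e s) m (by lia)
      rw [← h1, hpr]
      refine Finset.sum_congr rfl fun t _ => ?_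
      dsimp only
      rw [if_pos (by lia)]
    · rw [hc s m (by lia)]
      refine Finset.sum_eq_zero fun t _ => ?_
      dsimp only
      rw [if_neg (by lia), mul_zero]
  refine ⟨g', ?_⟩
  have hext : g' ∘ₗ r.d l = f ∘ₗ (r.d l).rangeRestrict := by
    ext s
    exact key s
  rintro ⟨_, z, rfl⟩
  exact LinearMap.congr_fun hext z

/-- A class in `Ext^i(Ω^l, A)` vanishes if its images in `Ext^i(Ω^l, A / A_{≥ n})` all vanish. -/
theorem ext_eq_zero_of_truncation [∀ i, Finite (r.ι i)] {i l : ℕ}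
    (x : Ext (r.syzygy l) (ModuleCat.of A A) i)
    (hx : ∀ n, x.comp (Ext.mk₀ (G.truncation n)) (add_zero i) = 0) : x = 0 := by
  induction i generalizing l with
  | zero =>
    obtain ⟨f, rfl⟩ := Ext.addEquiv₀.symm.surjective x
    simp only [Ext.addEquiv₀_symm_apply, Ext.mk₀_comp_mk₀, Ext.mk₀_eq_zero_iff] at hx ⊢
    ext z
    refine G.eq_zero_of_proj fun m => ?_
    have : (G.truncation (m + 1)).hom (f.hom z) = 0 :=
      congrArg (fun q => q.hom z) (hx (m + 1))
    rw [G.truncation_eq_zero] at this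
    exact this m (by lia)
  | succ i ih =>
    obtain ⟨y, rfl⟩ := Ext.contravariant_sequence_exact₃ (r.shortExact l) _ x
      (Ext.eq_zero_of_projective (P := r.term l) _) (add_comm 1 i)
    have hy : ∀ n, ∃ u : Ext (r.term l) (ModuleCat.of A (A ⧸ G.tail n)) i,
        (Ext.mk₀ (r.incl l)).comp u (zero_add i) =
          y.comp (Ext.mk₀ (G.truncation n)) (add_zero i) := fun n => by
      refine Ext.contravariant_sequence_exact₁ (r.shortExact l) _ _ (add_comm 1 i) ?_
      rw [← Ext.comp_assoc (r.shortExact l).extClass y (Ext.mk₀ (G.truncation n)) (add_comm 1 i)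
        (add_zero i) (by lia)]
      exact hx n
    -- In degree 1 the class comes from a homomorphism Ω^{l+1} → A which extends to P_l modulo every
    -- A_{≥n}, hence extends. In higher degrees the connecting maps are injective and the induction
    -- applies to Ω^{l+1}.
    cases i with
    | zero =>
      obtain ⟨f, rfl⟩ := Ext.addEquiv₀.symm.surjective y
      obtain ⟨g, hg⟩ := r.exists_extension l f.hom fun n => by
        obtain ⟨u, hu⟩ := hy n
        obtain ⟨q, rfl⟩ := Ext.addEquiv₀.symm.surjective u
        simp only [Ext.addEquiv₀_symm_apply, Ext.mk₀_comp_mk₀] at hu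
        have hu' := (Ext.mk₀_bijective _ _).1 hu
        choose a ha using fun t => (G.tail n).mkQ_surjective (q.hom (Finsupp.single t 1))
        refine ⟨Finsupp.linearCombination A a, fun (z : LinearMap.range (r.d l)) => ?_⟩
        have h1 : (G.tail n).mkQ ∘ₗ Finsupp.linearCombination A a = q.hom := by
          ext t
          simpa using ha t
        have h2 := LinearMap.congr_fun h1 z
        have h3 : q.hom (z : r.ι l →₀ A) = (G.tail n).mkQ (f.hom z) :=
          congrArg (fun q => q.hom z) hu'
        rw [h3] at h2
        exact (Submodule.Quotient.eq _).1 h2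
      have : (Ext.mk₀ (r.incl l)).comp (Ext.mk₀ (ModuleCat.ofHom g)) (zero_add 0) =
          Ext.addEquiv₀.symm f := by
        rw [Ext.mk₀_comp_mk₀, Ext.addEquiv₀_symm_apply]
        congr 1
        ext z
        exact hg z
      rw [← this]
      exact (r.shortExact l).extClass_comp_assoc _
    | succ i =>
      suffices h0 : y = 0 by rw [h0, Ext.comp_zero]
      refine ih (l := l + 1) y fun n => ?_
      obtain ⟨u, hu⟩ := hy n
      rw [← hu, Ext.eq_zero_of_projective u, Ext.comp_zero]

end MinimalResolution

end Syzygies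

/-! ### Filtered modules and the global dimension -/

section Filtered

variable {k : Type u} [Field k] {A : Type u} [Ring A] [Algebra k A] {ε : A →ₐ[k] k}

/-- A filtration of an `A`-module `M`, whose associated graded module is embedded in `W` by its
symbol maps. -/
structure SymbolFiltration (G : ConnectedGrading ε) (M W : Type u) [AddCommGroup M] [Module A M]
    [AddCommGroup W] [Module A W] where
  F : ℤ → AddSubgroup M
  symbol : ℤ → M →+ W
  le_succ : ∀ n, F n ≤ F (n + 1)
  eq_bot : ∀ n < 0, F n = ⊥
  exhaustive : ∀ x, ∃ n, x ∈ F n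
  smul_mem : ∀ m n, ∀ a ∈ G.piece m, ∀ x ∈ F n, a • x ∈ F (m + n)
  symbol_smul : ∀ m n, ∀ a ∈ G.piece m, ∀ x ∈ F n, symbol (m + n) (a • x) = a • symbol n x
  symbol_eq_zero : ∀ n, ∀ x ∈ F n, (symbol n x = 0 ↔ x ∈ F (n - 1))

namespace SymbolFiltration

variable {G : ConnectedGrading ε} {M W : Type u} [AddCommGroup M] [Module A M] [AddCommGroup W]
  [Module A W] (Φ : SymbolFiltration G M W) {ι : Type u} {δ : ι → ℤ}

theorem mono : Monotone Φ.F := monotone_int_of_le_succ Φ.le_succ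

/-- The associated graded module of the filtration is the image of the graded map `T`. -/
def IsImage (δ : ι → ℤ) (T : (ι →₀ A) →ₗ[A] W) : Prop :=
  ∀ n, (∀ p ∈ (G.free δ).piece n, ∃ x ∈ Φ.F n, Φ.symbol n x = T p) ∧
    ∀ x ∈ Φ.F n, ∃ p ∈ (G.free δ).piece n, Φ.symbol n x = T p

variable {Φ} {T : (ι →₀ A) →ₗ[A] W}

/-- Choose elements whose symbols are the images of the basis vectors and extend linearly. -/
theorem IsImage.exists_lift (h : Φ.IsImage δ T) : ∃ f : (ι →₀ A) →ₗ[A] M,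
    ∀ n, ∀ p ∈ (G.free δ).piece n, f p ∈ Φ.F n ∧ Φ.symbol n (f p) = T p := by
  choose x hx hx' using fun s => (h (δ s)).1 (Finsupp.single s 1)
    (G.single_mem_free δ G.one_mem (zero_add _))
  refine ⟨Finsupp.linearCombination A x, fun n p hp => ?_⟩
  rw [Finsupp.linearCombination_apply, Finsupp.sum]
  have hmem : ∀ s, p s • x s ∈ Φ.F n := fun s => by
    have := Φ.smul_mem _ _ _ (hp s) _ (hx s)
    rwa [sub_add_cancel] at this
  refine ⟨AddSubgroup.sum_mem _ fun s _ => hmem s, ?_⟩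
  rw [map_sum]
  conv_rhs => rw [← Finsupp.sum_single p, Finsupp.sum, map_sum]
  refine Finset.sum_congr rfl fun s _ => ?_
  have := Φ.symbol_smul _ _ _ (hp s) _ (hx s)
  rw [sub_add_cancel, hx', ← map_smul, Finsupp.smul_single, smul_eq_mul, mul_one] at this
  exact this

/-- The part of filtration degree at most `n` of a graded module. -/
def below {P : Type u} [AddCommGroup P] [Module k P] (H : VectorGrading k P) (n : ℤ) :
    AddSubgroup P where
  carrier := {p | ∀ m, n < m → H.proj m p = 0}
  add_mem' ha hb m hm := by rw [map_add, ha m hm, hb m hm, add_zero]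
  zero_mem' m _ := map_zero _
  neg_mem' ha m hm := by rw [map_neg, ha m hm, neg_zero]

theorem piece_le_below {P : Type u} [AddCommGroup P] [Module k P] (H : VectorGrading k P) {n : ℤ}
    {p : P} (hp : p ∈ H.piece n) : p ∈ below H n := fun _ hm => H.proj_of_ne _ _ _ hp hm.ne

theorem below_mono {P : Type u} [AddCommGroup P] [Module k P] (H : VectorGrading k P) {m n : ℤ}
    (h : m ≤ n) : below H m ≤ below H n := fun _ hp l hl => hp l (h.trans_lt hl)

variable (hδ : ∀ s, 0 ≤ δ s) {f : (ι →₀ A) →ₗ[A] M}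
  (hf : ∀ n, ∀ p ∈ (G.free δ).piece n, f p ∈ Φ.F n ∧ Φ.symbol n (f p) = T p)

include hf in
theorem lift_mem {n : ℤ} {p : ι →₀ A} (hp : p ∈ below (G.free δ) n) : f p ∈ Φ.F n := by
  obtain ⟨s, hs⟩ := (G.free δ).exists_sum p
  rw [← hs, map_sum]
  refine AddSubgroup.sum_mem _ fun m _ => ?_
  rcases le_or_gt m n with hm | hm
  · exact Φ.mono hm (hf m _ ((G.free δ).proj_mem _ _)).1
  · rw [hp m hm, map_zero]; exact zero_mem _

include hf in
theorem symbol_lift {n : ℤ} {p : ι →₀ A} (hp : p ∈ below (G.free δ) n) :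
    Φ.symbol n (f p) = T ((G.free δ).proj n p) := by
  have h1 : p - (G.free δ).proj n p ∈ below (G.free δ) (n - 1) := by
    intro m hm
    rw [map_sub, (G.free δ).proj_proj]
    rcases eq_or_ne n m with rfl | hnm
    · rw [if_pos rfl, sub_self]
    · rw [if_neg hnm, hp m (by lia), sub_zero]
  have h2 := lift_mem hf h1
  have h3 := (Φ.symbol_eq_zero n _ (Φ.mono (by lia) h2)).2 h2
  rw [map_sub, map_sub, sub_eq_zero] at h3
  rw [h3, (hf n _ ((G.free δ).proj_mem _ _)).2]

include hf in
-- Remove the leading symbol and continue with the remainder one step lower in the filtration; this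
-- stops because the filtration is zero in negative degrees. So the lift is surjective on each
-- filtration step.
theorem IsImage.exists_below (h : Φ.IsImage δ T) {n : ℤ} {x : M} (hx : x ∈ Φ.F n) :
    ∃ p ∈ below (G.free δ) n, f p = x := by
  have key : ∀ N : ℕ, ∀ n : ℤ, n < N → ∀ x ∈ Φ.F n, ∃ p ∈ below (G.free δ) n, f p = x := by
    intro N
    induction N with
    | zero =>
      intro n hn x hx
      rw [Φ.eq_bot n (by simpa using hn)] at hx
      exact ⟨0, zero_mem _, by rw [map_zero, (AddSubgroup.mem_bot.1 hx)]⟩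
    | succ N ih =>
      intro n hn x hx
      obtain ⟨p, hp, hpx⟩ := (h n).2 x hx
      obtain ⟨hp1, hp2⟩ := hf n p hp
      obtain ⟨q, hq, hqx⟩ := ih (n - 1) (by push_cast at hn; lia) (x - f p)
        ((Φ.symbol_eq_zero n _ (sub_mem hx hp1)).1 (by rw [map_sub, hp2, hpx, sub_self]))
      exact ⟨q + p, add_mem (below_mono _ (by lia) hq) (piece_le_below _ hp), by
        rw [map_add, hqx, sub_add_cancel]⟩
  exact key (n.toNat + 1) n (by push_cast; lia) x hx

/-- The filtration of the kernel of a lift, with symbols in the free module. -/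
noncomputable def kernel (f : (ι →₀ A) →ₗ[A] M) (hδ : ∀ s, 0 ≤ δ s) :
    SymbolFiltration G (LinearMap.ker f) (ι →₀ A) where
  F n := (below (G.free δ) n).comap (LinearMap.ker f).subtype.toAddMonoidHom
  symbol n := ((G.free δ).proj n).toAddMonoidHom.comp (LinearMap.ker f).subtype.toAddMonoidHom
  le_succ n x hx := below_mono _ (by lia) hx
  eq_bot n hn := by
    rw [eq_bot_iff]
    intro x hx
    refine Subtype.ext ((G.free δ).eq_zero_of_proj fun m => ?_)
    rcases le_or_gt m n with hm | hm
    · exact G.free_proj_neg hδ (by lia) _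
    · exact hx m hm
  exhaustive x := by
    obtain ⟨s, hs, -⟩ := (G.free δ).exists_support x.1
    obtain ⟨B, hB⟩ := s.bddAbove
    exact ⟨B, fun m hm => hs m fun hms => absurd (hB hms) (not_le.2 hm)⟩
  smul_mem m n a ha x hx l hl := by
    change (G.free δ).proj l (a • x.1) = 0
    have : (G.free δ).proj (l - m) x.1 = 0 := hx (l - m) (by lia)
    rw [G.free_proj_smul δ ha, this, smul_zero]
  symbol_smul m n a ha x hx := by
    change (G.free δ).proj (m + n) (a • x.1) = a • (G.free δ).proj n x.1
    rw [G.free_proj_smul δ ha, add_sub_cancel_left]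
  symbol_eq_zero n x hx := by
    constructor
    · intro h m hm
      rcases eq_or_ne m n with rfl | hmn
      · exact h
      · exact hx m (by lia)
    · exact fun h => h n (by lia)

include hf in
-- The lift is strict, so the symbols of its kernel are the homogeneous elements of the kernel of
-- `T`: an element `T' q` of the latter is mapped by `f` one step lower, and subtracting a
-- correction of lower degree puts it in the kernel of `f`. This lets the resolution be lifted term
-- by term.
theorem IsImage.kernel (h : Φ.IsImage δ T) {ι' : Type u} {δ' : ι' → ℤ}
    {T' : (ι' →₀ A) →ₗ[A] (ι →₀ A)} (hT' : ∀ n, ∀ x ∈ (G.free δ').piece n, T' x ∈ (G.free δ).piece n)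
    (hr : LinearMap.range T' = LinearMap.ker T) :
    (SymbolFiltration.kernel (G := G) f hδ).IsImage δ' T' := by
  intro n
  constructor
  · intro q hq
    have h1 := hT' n q hq
    have h0 : T (T' q) = 0 := by
      rw [← LinearMap.mem_ker, ← hr]; exact ⟨q, rfl⟩
    obtain ⟨h2, h3⟩ := hf n _ h1
    rw [h0, Φ.symbol_eq_zero n _ h2] at h3
    obtain ⟨y, hy, hy'⟩ := h.exists_below hf h3
    refine ⟨⟨T' q - y, by rw [LinearMap.mem_ker, map_sub, hy', sub_self]⟩,
      sub_mem (piece_le_below _ h1) (below_mono _ (by lia) hy), ?_⟩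
    change (G.free δ).proj n (T' q - y) = T' q
    rw [map_sub, hy n (by lia), sub_zero, (G.free δ).proj_of_mem _ _ h1]
  · intro z hz
    have h1 := symbol_lift hf hz
    have h0 : f z.1 = 0 := z.2
    change Φ.symbol n (f z.1) = T ((G.free δ).proj n z.1) at h1
    rw [h0, map_zero, eq_comm, ← LinearMap.mem_ker, ← hr] at h1
    obtain ⟨q, hq⟩ := h1
    refine ⟨(G.free δ').proj n q, (G.free δ').proj_mem _ _, ?_⟩
    change (G.free δ).proj n z.1 = _
    rw [(G.free δ').map_proj (G.free δ) T' hT', hq, (G.free δ).proj_proj, if_pos rfl]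

end SymbolFiltration

/-- A filtered module has projective dimension less than `l` if its associated graded module has a
graded free resolution of length less than `l`. -/
theorem SymbolFiltration.hasProjectiveDimensionLT {G : ConnectedGrading ε} (ι : ℕ → Type u)
    (δ : ∀ i, ι i → ℤ) (hδ : ∀ i s, 0 ≤ δ i s) (T : ∀ i, (ι (i + 1) →₀ A) →ₗ[A] (ι i →₀ A))
    (hT : ∀ i n, ∀ x ∈ (G.free (δ (i + 1))).piece n, T i x ∈ (G.free (δ i)).piece n)
    (hr : ∀ i, LinearMap.range (T (i + 1)) = LinearMap.ker (T i)) (l : ℕ) :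
    ∀ (i : ℕ) (M W : Type u) [AddCommGroup M] [Module A M] [AddCommGroup W] [Module A W]
      (Φ : SymbolFiltration G M W) (U : (ι i →₀ A) →ₗ[A] W), Φ.IsImage (δ i) U →
      LinearMap.range (T i) = LinearMap.ker U → IsEmpty (ι (i + l)) →
      HasProjectiveDimensionLT (ModuleCat.of A M) l := by
  induction l with
  | zero =>
    intro i M W _ _ _ _ Φ U hU _ hι
    obtain ⟨f, hf⟩ := hU.exists_lift
    have : ∀ x : M, x = 0 := fun x => by
      obtain ⟨n, hn⟩ := Φ.exhaustive x
      obtain ⟨p, -, rfl⟩ := hU.exists_below hf hn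
      have hι' : IsEmpty (ι i) := hι
      rw [Subsingleton.elim p 0, map_zero]
    have : Subsingleton M := ⟨fun x y => by rw [this x, this y]⟩
    exact (ModuleCat.isZero_of_subsingleton (ModuleCat.of A M)).hasProjectiveDimensionLT_zero
  | succ l ih =>
    intro i M W _ _ _ _ Φ U hU hrU hι
    obtain ⟨f, hf⟩ := hU.exists_lift
    have hsurj : Function.Surjective f := fun x => by
      obtain ⟨n, hn⟩ := Φ.exhaustive x
      obtain ⟨p, -, hp⟩ := hU.exists_below hf hn
      exact ⟨p, hp⟩
    have h1 := ih (i + 1) _ _ _ _ (hU.kernel (hδ i) hf (hT i) hrU) (hr i)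
      (by rwa [add_right_comm])
    have hS := LinearMap.shortExact_shortComplexKer hsurj
    exact hS.hasProjectiveDimensionLT_X₃ l h1
      (hasProjectiveDimensionLT_of_ge (ModuleCat.of A (ι i →₀ A)) 1 (l + 1) (by lia))

theorem range_mapRange_eq_ker (B : Type u) {M₁ M₂ M₃ : Type u} [AddCommGroup M₁] [AddCommGroup M₂]
    [AddCommGroup M₃] [Module A M₁] [Module A M₂] [Module A M₃] {f : M₁ →ₗ[A] M₂} {g : M₂ →ₗ[A] M₃}
    (h : LinearMap.range f = LinearMap.ker g) :
    LinearMap.range (Finsupp.mapRange.linearMap (α := B) f) =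
      LinearMap.ker (Finsupp.mapRange.linearMap (α := B) g) := by
  classical
  refine le_antisymm ?_ fun y hy => ?_
  · rintro _ ⟨x, rfl⟩
    rw [LinearMap.mem_ker]
    ext b
    exact LinearMap.mem_ker.1 (h ▸ LinearMap.mem_range_self f (x b))
  · rw [← Finsupp.sum_single y]
    refine Submodule.sum_mem _ fun b _ => ?_
    have hb : y b ∈ LinearMap.range f := by
      rw [h]; exact DFunLike.congr_fun hy b
    obtain ⟨x, hx⟩ := hb
    refine ⟨Finsupp.single b x, ?_⟩
    rw [← hx]
    exact Finsupp.mapRange_single (hf := map_zero f)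

/-- A homomorphism of free modules, tensored with a vector space with basis `B`. -/
noncomputable def finsuppMap (B : Type u) {ι ι' : Type u} (d : (ι' →₀ A) →ₗ[A] (ι →₀ A)) :
    (B × ι' →₀ A) →ₗ[A] (B × ι →₀ A) :=
  (Finsupp.curryLinearEquiv A).symm.toLinearMap ∘ₗ Finsupp.mapRange.linearMap d ∘ₗ
    (Finsupp.curryLinearEquiv A).toLinearMap

theorem finsuppMap_apply (B : Type u) {ι ι' : Type u} (d : (ι' →₀ A) →ₗ[A] (ι →₀ A))
    (x : B × ι' →₀ A) (b : B) (t : ι) : finsuppMap B d x (b, t) = d (x.curry b) t := by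
  rfl

theorem range_finsuppMap (B : Type u) {ι ι' : Type u} {W : Type u} [AddCommGroup W] [Module A W]
    {d : (ι' →₀ A) →ₗ[A] (ι →₀ A)} {g : (ι →₀ A) →ₗ[A] W}
    (h : LinearMap.range d = LinearMap.ker g) :
    LinearMap.range (finsuppMap B d) = LinearMap.ker
      (Finsupp.mapRange.linearMap g ∘ₗ (Finsupp.curryLinearEquiv (α := B) A).toLinearMap) := by
  rw [LinearMap.ker_comp, ← range_mapRange_eq_ker B h, finsuppMap, ← LinearMap.comp_assoc,
    LinearMap.range_comp_of_range_eq_top _ (LinearEquiv.range _), LinearMap.range_comp]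
  exact Submodule.map_equiv_eq_comap_symm _ _

namespace MinimalResolution

variable {G : ConnectedGrading ε} (r : MinimalResolution G)

/-- The projective dimension of every module is bounded by the length of a minimal resolution of
the trivial module. -/
theorem hasProjectiveDimensionLT {l : ℕ} (h : IsEmpty (r.ι l)) (M : ModuleCat.{u} A) :
    HasProjectiveDimensionLT M l := by
  classical
  let : Module k M := Module.compHom M (algebraMap k A)
  have hsmul : ∀ (c : k) (x : M), c • x = algebraMap k A c • x := fun _ _ => rfl
  let b := Module.Basis.ofVectorSpace k M
  let B := Module.Basis.ofVectorSpaceIndex k M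
  let e : M →+ (B →₀ TrivialModule ε) := b.repr.toLinearMap.toAddMonoidHom
  have he : ∀ (a : A) (w : B →₀ TrivialModule ε) (i : B), (a • w) i = (ε a * (show k from w i) : k) :=
    fun _ _ _ => rfl
  have he' : ∀ (c : k) (x : M) (i : B), (e (c • x)) i = (c * (show k from e x i) : k) := fun c x i => by
    change b.repr (c • x) i = _
    rw [map_smul]; rfl
  have he0 : ∀ x, e x = 0 → x = 0 := fun x hx => b.repr.map_eq_zero_iff.1 hx
  -- All of `M` is put in filtration degree 0. The associated graded module is then `M` with A₊
  -- acting by zero, a sum of copies of k indexed by a basis, and it is resolved by as many copies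
  -- of `r`.
  let Φ : SymbolFiltration G M (B →₀ TrivialModule ε) :=
    { F := fun n => if 0 ≤ n then ⊤ else ⊥
      symbol := fun n => if n = 0 then e else 0
      le_succ := fun n => by
        split_ifs with h1 h2
        · exact le_rfl
        · lia
        · exact bot_le
        · exact le_rfl
      eq_bot := fun n hn => if_neg (by lia)
      exhaustive := fun x => ⟨0, by simp⟩
      smul_mem := fun m n a ha x hx => by
        by_cases hn : 0 ≤ n
        · rcases lt_or_ge m 0 with hm | hm
          · rw [G.eq_bot m hm, Submodule.mem_bot] at ha
            rw [ha, zero_smul]; exact zero_mem _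
          · rw [if_pos (by lia)]; trivial
        · rw [if_neg hn, AddSubgroup.mem_bot] at hx
          rw [hx, smul_zero]; exact zero_mem _
      symbol_smul := fun m n a ha x hx => by
        by_cases hn : 0 ≤ n
        · rcases lt_or_ge m 0 with hm | hm
          · rw [G.eq_bot m hm, Submodule.mem_bot] at ha
            rw [ha, zero_smul, zero_smul, map_zero]
          · by_cases hn0 : n = 0
            · subst hn0
              by_cases hm0 : m = 0
              · subst hm0
                have ha' := G.mem_zero a ha
                rw [add_zero, if_pos rfl]
                ext i
                rw [he]
                conv_lhs => rw [ha', ← hsmul, he']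
              · rw [if_neg (by lia), if_pos rfl]
                ext i
                rw [he, G.aug_eq_zero m a ha hm0]
                exact (zero_mul (M₀ := k) _).symm
            · rw [if_neg (by lia), if_neg hn0]
              exact (smul_zero a).symm
        · rw [if_neg hn, AddSubgroup.mem_bot] at hx
          rw [hx, smul_zero, map_zero, map_zero, smul_zero]
      symbol_eq_zero := fun n x hx => by
        rcases lt_trichotomy n 0 with hn | rfl | hn
        · rw [if_neg (by lia), AddSubgroup.mem_bot] at hx
          rw [hx, map_zero]
          exact ⟨fun _ => zero_mem _, fun _ => rfl⟩
        · rw [if_pos rfl, if_neg (by lia), AddSubgroup.mem_bot]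
          exact ⟨he0 x, fun h => by rw [h, map_zero]⟩
        · rw [if_neg (by lia), if_pos (by lia)]
          exact ⟨fun _ => trivial, fun _ => rfl⟩ }
  have hpiece : ∀ i n, ∀ x ∈ (G.free fun p : B × r.ι i => r.δ i p.2).piece n, ∀ β,
      x.curry β ∈ (G.free (r.δ i)).piece n := fun i n x hx β s => hx (β, s)
  have haug : ∀ n ≠ 0, ∀ x ∈ (G.free (r.δ 0)).piece n, r.aug x = 0 := fun n hn x hx => by
    rw [← LinearMap.mem_ker, r.ker_aug, ConnectedGrading.mem_aug_smul_top]
    refine fun s => G.aug_eq_zero _ _ (hx s) ?_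
    rwa [r.δ_zero, sub_zero]
  let U : (B × r.ι 0 →₀ A) →ₗ[A] (B →₀ TrivialModule ε) :=
    Finsupp.mapRange.linearMap r.aug ∘ₗ (Finsupp.curryLinearEquiv A).toLinearMap
  have hU : ∀ x β, U x β = r.aug (x.curry β) := fun _ _ => rfl
  refine SymbolFiltration.hasProjectiveDimensionLT (fun i => B × r.ι i) (fun i p => r.δ i p.2)
    (fun i p => r.δ_nonneg i p.2) (fun i => finsuppMap B (r.d i)) ?_ ?_ l 0 M _ Φ U ?_
    (range_finsuppMap B r.range_zero) ?_
  · rintro i n x hx ⟨β, t⟩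
    rw [finsuppMap_apply]
    exact r.d_mem i n _ (hpiece _ n x hx β) t
  · intro i
    rw [range_finsuppMap B (r.range_succ i)]
    exact (LinearMap.ker_comp_of_ker_eq_bot _ (LinearEquiv.ker _)).symm
  · intro n
    rcases eq_or_ne n 0 with rfl | hn
    · refine ⟨fun p _ => ?_, fun x _ => ?_⟩
      · obtain ⟨x, hx⟩ := b.repr.surjective (U p)
        exact ⟨x, trivial, hx⟩
      · let s := r.unique_zero.default
        let q : B × r.ι 0 →₀ A := (b.repr x).sum fun β c => Finsupp.single (β, s) (algebraMap k A c)
        refine ⟨q, ?_, ?_⟩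
        · refine Submodule.sum_mem _ fun β _ => G.single_mem_free _ (m := 0) ?_ ?_
          · rw [Algebra.algebraMap_eq_smul_one]
            exact Submodule.smul_mem _ _ G.one_mem
          · exact (zero_add _).trans (r.δ_zero s)
        · have hsing : ∀ β (c : k), U (Finsupp.single (β, s) (algebraMap k A c)) =
              (Finsupp.single β c : B →₀ k) := by
            intro β c
            change Finsupp.mapRange.linearMap r.aug (Finsupp.curry _) = _
            rw [Finsupp.curry_single]
            refine (Finsupp.mapRange_single (hf := map_zero r.aug)).trans ?_
            rw [r.aug_single, AlgHom.commutes]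
            rfl
          change e x = U q
          simp only [q, Finsupp.sum, map_sum, hsing]
          exact (Finsupp.sum_single (b.repr x)).symm
    · refine ⟨fun p hp => ⟨0, zero_mem _, ?_⟩, fun x _ => ⟨0, zero_mem _, ?_⟩⟩
      · rw [map_zero]
        ext β
        rw [hU, haug n hn _ (hpiece 0 n p hp β)]
        rfl
      · rw [map_zero]
        change (if n = 0 then e else 0) x = 0
        rw [if_neg hn]; rfl
  · rw [zero_add]
    infer_instance

end MinimalResolution

end Filtered

/-! ### From perfect pairings to the Frobenius property -/

section Frobenius

variable {k : Type u} [Field k] {A : Type u} [Ring A] [Algebra k A] {ε : A →ₐ[k] k}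

/-- The linear form on the Yoneda algebra which is given by `φ` in degree `d` and vanishes in the
other degrees. -/
noncomputable def degreeForm {d : ℕ} (φ : YonedaExt ε d →ₗ[k] k) : YonedaAlgebra ε →ₗ[k] k :=
  φ ∘ₗ DirectSum.component k ℕ (YonedaExt ε) d

theorem yoneda_of_mul_of {i j d : ℕ} (f : YonedaExt ε i) (g : YonedaExt ε j) (h : i + j = d) :
    DirectSum.of (YonedaExt ε) j g * DirectSum.of (YonedaExt ε) i f =
      DirectSum.of (YonedaExt ε) d (Ext.comp f g h) := by
  rw [DirectSum.of_mul_of]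
  exact DirectSum.of_eq_of_gradedMonoid_eq (YonedaExt.mk_comp_eq f g (add_comm i j) h)

theorem degreeForm_mul {d : ℕ} (φ : YonedaExt ε d →ₗ[k] k) {i j : ℕ} (f : YonedaExt ε i)
    (g : YonedaExt ε j) (h : i + j = d) :
    degreeForm φ (DirectSum.of (YonedaExt ε) j g * DirectSum.of (YonedaExt ε) i f) =
      φ (Ext.comp f g h) := by
  rw [yoneda_of_mul_of f g h]
  exact congrArg φ (DirectSum.of_eq_same _ _)

theorem degreeForm_mul_of_ne {d : ℕ} (φ : YonedaExt ε d →ₗ[k] k) {i j : ℕ} (f : YonedaExt ε i)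
    (g : YonedaExt ε j) (h : i + j ≠ d) :
    degreeForm φ (DirectSum.of (YonedaExt ε) j g * DirectSum.of (YonedaExt ε) i f) = 0 := by
  rw [yoneda_of_mul_of f g rfl]
  refine (congrArg φ (DirectSum.of_eq_of_ne _ _ _ h.symm)).trans (map_zero φ)

theorem finite_yonedaAlgebra {D : ℕ} (hfin : ∀ i, Module.Finite k (YonedaExt ε i))
    (h0 : ∀ i, D < i → ∀ x : YonedaExt ε i, x = 0) : Module.Finite k (YonedaAlgebra ε) := by
  let L : YonedaAlgebra ε →ₗ[k] (∀ i : Fin (D + 1), YonedaExt ε i) :=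
    LinearMap.pi fun i => DirectSum.component k ℕ (YonedaExt ε) i
  refine Module.Finite.of_injective L fun x y hxy => ?_
  refine DFinsupp.ext fun i => ?_
  by_cases hi : i < D + 1
  · exact congrFun hxy ⟨i, hi⟩
  · exact (h0 i (by lia) _).trans (h0 i (by lia) _).symm

/-- The map a ↦ (c ↦ λ(ca)), with λ = `degreeForm φ`, is left linear. It is onto since the degree D
- i part of a form is represented by an element of degree i, and a surjection between spaces of
equal finite dimension is bijective. -/
theorem isFrobenius_of_pairing [Module.Finite k (YonedaAlgebra ε)] {D : ℕ}
    (h0 : ∀ i, D < i → ∀ x : YonedaExt ε i, x = 0) (φ : YonedaExt ε D →ₗ[k] k)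
    (hφ : ∀ i j (h : i + j = D), PairingSurjective φ (trivialModule ε) i j h) :
    IsFrobenius k (YonedaAlgebra ε) := by
  classical
  let e : YonedaAlgebra ε →ₗ[k] Module.Dual k (YonedaAlgebra ε) :=
    (LinearMap.mul k (YonedaAlgebra ε)).flip.compr₂ (degreeForm φ)
  have he : ∀ a c, e a c = degreeForm φ (c * a) := fun _ _ => rfl
  have hsurj : Function.Surjective e := by
    intro ψ
    choose x hx using fun i : Fin (D + 1) => hφ i (D - i) (by lia)
      (ψ ∘ₗ DirectSum.lof k ℕ (YonedaExt ε) (D - i))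
    refine ⟨∑ i : Fin (D + 1), DirectSum.of (YonedaExt ε) i (x i), ?_⟩
    ext j y
    change e _ (DirectSum.of (YonedaExt ε) j y) = ψ (DirectSum.of (YonedaExt ε) j y)
    rw [he, Finset.mul_sum, map_sum]
    by_cases hj : j ≤ D
    · obtain ⟨i, rfl⟩ := Nat.exists_eq_add_of_le' hj
      rw [Finset.sum_eq_single (⟨i, by lia⟩ : Fin (i + j + 1))]
      · rw [degreeForm_mul φ _ y rfl]
        have hij : i + j - i = j := by lia
        -- The degree i + j - i is equal to j, but not definitionally.
        have key : ∀ (j' : ℕ) (hj' : j' = j) (h : i + j' = i + j),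
            (∀ y' : YonedaExt ε j', φ ((x ⟨i, by lia⟩).comp y' h) =
              ψ (DirectSum.of (YonedaExt ε) j' y')) →
            φ ((x ⟨i, by lia⟩).comp y rfl) = ψ (DirectSum.of (YonedaExt ε) j y) := by
          rintro _ rfl h hy
          exact hy y
        exact key _ hij (by lia) (hx ⟨i, by lia⟩)
      · intro l _ hl
        exact degreeForm_mul_of_ne _ _ _ fun h => hl (Fin.ext (by simp only; lia))
      · simp
    · rw [h0 j (by lia) y, map_zero, map_zero]
      exact Finset.sum_eq_zero fun i _ => by rw [zero_mul, map_zero]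
  have hinj : Function.Injective e :=
    (LinearMap.injective_iff_surjective_of_finrank_eq_finrank Subspace.dual_finrank_eq.symm).2 hsurj
  refine ⟨inferInstance, LinearEquiv.ofBijective e ⟨hinj, hsurj⟩, fun a b c => ?_⟩
  change e (a * b) c = e b (c * a)
  rw [he, he, mul_assoc]

end Frobenius

/-! ### AS-Gorenstein implies Frobenius -/

section Gorenstein

variable {k : Type u} [Field k] {A : Type u} [Ring A] [Algebra k A] {ε : A →ₐ[k] k}

theorem hom_free_eq_sum {J : Type u} [Fintype J] [DecidableEq J] :
    𝟙 (ModuleCat.of A (J →₀ A)) =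
      ∑ s, (ModuleCat.ofHom (Finsupp.lapply s) : ModuleCat.of A (J →₀ A) ⟶ ModuleCat.of A A) ≫
        ModuleCat.ofHom (Finsupp.lsingle s) := by
  ext s
  rw [ModuleCat.hom_sum]
  simp [Finsupp.single_apply]

theorem ext_to_free_eq_sum {J : Type u} [Fintype J] {M : ModuleCat.{u} A} {i : ℕ}
    (x : Ext M (ModuleCat.of A (J →₀ A)) i) :
    x = ∑ s, (x.comp (Ext.mk₀ (ModuleCat.ofHom (Finsupp.lapply s))) (add_zero i)).comp
      (Ext.mk₀ (ModuleCat.ofHom (Finsupp.lsingle s))) (add_zero i) := by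
  classical
  conv_lhs => rw [← Ext.comp_mk₀_id x, hom_free_eq_sum, Ext.mk₀_sum, Ext.comp_sum]
  refine Finset.sum_congr rfl fun s _ => ?_
  rw [← Ext.mk₀_comp_mk₀, Ext.comp_assoc_of_third_deg_zero]

theorem ext_from_free_eq_sum {J : Type u} [Fintype J] {M : ModuleCat.{u} A} {i : ℕ}
    (y : Ext (ModuleCat.of A (J →₀ A)) M i) :
    y = ∑ s, (Ext.mk₀ (ModuleCat.ofHom (Finsupp.lapply s))).comp
      ((Ext.mk₀ (ModuleCat.ofHom (Finsupp.lsingle s))).comp y (zero_add i)) (zero_add i) := by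
  classical
  conv_lhs => rw [← Ext.mk₀_id_comp y, hom_free_eq_sum, Ext.mk₀_sum, Ext.sum_comp]
  refine Finset.sum_congr rfl fun s _ => ?_
  rw [← Ext.mk₀_comp_mk₀, Ext.comp_assoc_of_second_deg_zero]

variable {D : ℕ} {φ : YonedaExt ε D →ₗ[k] k}

theorem PairingInjective.free {J : Type u} [Finite J] {i j : ℕ} {h : i + j = D}
    (hA : PairingInjective φ (ModuleCat.of A A) i j h) :
    PairingInjective φ (ModuleCat.of A (J →₀ A)) i j h := by
  intro x hx
  have := Fintype.ofFinite J
  rw [ext_to_free_eq_sum x]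
  refine Finset.sum_eq_zero fun s _ => ?_
  rw [hA (x.comp (Ext.mk₀ (ModuleCat.ofHom (Finsupp.lapply s))) (add_zero i)) fun y => ?_,
    Ext.zero_comp]
  rw [Ext.comp_assoc_of_second_deg_zero, hx]

theorem PairingSurjective.free {J : Type u} [Finite J] {i j : ℕ} {h : i + j = D}
    (hA : PairingSurjective φ (ModuleCat.of A A) i j h) :
    PairingSurjective φ (ModuleCat.of A (J →₀ A)) i j h := by
  intro ψ
  have := Fintype.ofFinite J
  choose x hx using fun s : J => hA (ψ ∘ₗ extPrecomp k
    (Ext.mk₀ (ModuleCat.ofHom (Finsupp.lapply s) : ModuleCat.of A (J →₀ A) ⟶ ModuleCat.of A A))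
    (trivialModule ε) (zero_add j))
  refine ⟨∑ s, (x s).comp (Ext.mk₀ (ModuleCat.ofHom (Finsupp.lsingle s))) (add_zero i),
    fun y => ?_⟩
  rw [Ext.sum_comp, map_sum]
  conv_rhs => rw [ext_from_free_eq_sum y, map_sum]
  refine Finset.sum_congr rfl fun s _ => ?_
  rw [Ext.comp_assoc_of_second_deg_zero, hx]
  rfl

theorem augHom_one : (augHom ε).hom (1 : A) = TrivialModule.one ε :=
  one_smul A _

theorem ext_zero_eq_smul_aug (y : Ext (ModuleCat.of A A) (trivialModule ε) 0) :
    ∃ b : k, y = b • Ext.mk₀ (augHom ε) := by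
  obtain ⟨f, rfl⟩ := Ext.addEquiv₀.symm.surjective y
  obtain ⟨b, hb⟩ : ∃ b : k, @Eq k (f.hom (1 : A)) b := ⟨_, rfl⟩
  refine ⟨b, ?_⟩
  rw [Ext.addEquiv₀_symm_apply, ← Ext.mk₀_smul]
  congr 1
  refine ModuleCat.hom_ext (LinearMap.ext_ring ?_)
  change f.hom (1 : A) = algebraMap k A b • (augHom ε).hom (1 : A)
  rw [augHom_one, TrivialModule.smul_one, AlgHom.commutes]
  exact hb

theorem rightMul_comp_augHom (a : A) : rightMul a ≫ augHom ε = ε a • augHom ε := by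
  refine ModuleCat.hom_ext (LinearMap.ext_ring ?_)
  change (augHom ε).hom ((1 : A) • a) = algebraMap k A (ε a) • (augHom ε).hom (1 : A)
  rw [one_smul, augHom_one, TrivialModule.smul_one, augHom_apply, AlgHom.commutes]
  rfl

namespace MinimalResolution

variable {G : ConnectedGrading ε}

/-- If the right ideal `A₊` acts by zero on `Ext^D(k, A)` then `Ext^D(k, A) → Ext^D(k, k)` is
injective. -/
theorem eq_zero_of_comp_augHom_eq_zero (r : MinimalResolution G) [∀ i, Finite (r.ι i)]
    [HasProjectiveDimensionLT (trivialModule ε) (D + 1)]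
    (e : Ext (trivialModule ε) (ModuleCat.of A A) D ≃ₗ[k] k)
    (he : ∀ (x : Ext (trivialModule ε) (ModuleCat.of A A) D) (a : A),
        e (x.comp (Ext.mk₀ (rightMul a)) (add_zero D)) = e x * ε a)
    (x : Ext (trivialModule ε) (ModuleCat.of A A) D)
    (hx : x.comp (Ext.mk₀ (augHom ε)) (add_zero D) = 0) : x = 0 := by
  have := Fintype.ofFinite (r.ι 1)
  let s₀ : r.ι 0 := r.unique_zero.default
  have hs₀ : ∀ s, s = s₀ := r.unique_zero.uniq
  have haug : ∀ f : r.ι 0 →₀ A, ε (f s₀) = 0 → f ∈ LinearMap.range (r.d 0) := fun f hf => by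
    rw [r.range_zero, r.ker_aug, ConnectedGrading.mem_aug_smul_top]
    intro s
    rw [hs₀ s, hf]
  -- P_0 has rank one, so the first differential is a map P_1 → A with image A₊.
  let q : (r.ι 1 →₀ A) →ₗ[A] A := Finsupp.lapply s₀ ∘ₗ r.d 0
  have hq : ∀ z, q z ∈ LinearMap.ker (augHom ε).hom := fun z => by
    rw [LinearMap.mem_ker, augHom_apply]
    exact ConnectedGrading.mem_aug_smul_top.1 (r.range_le 0 ⟨z, rfl⟩) s₀
  let p : (r.ι 1 →₀ A) →ₗ[A] LinearMap.ker (augHom ε).hom := q.codRestrict _ hq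
  have hp : Function.Surjective p := by
    rintro ⟨a, ha⟩
    rw [LinearMap.mem_ker, augHom_apply] at ha
    obtain ⟨z, hz⟩ := haug (Finsupp.single s₀ a) (by rw [Finsupp.single_eq_same]; exact ha)
    refine ⟨z, Subtype.ext ?_⟩
    change r.d 0 z s₀ = a
    rw [hz, Finsupp.single_eq_same]
  have hsurj : Function.Surjective (augHom ε).hom := fun c =>
    ⟨algebraMap k A c, by rw [augHom_apply]; exact ε.commutes c⟩
  obtain ⟨w, hw⟩ := Ext.covariant_sequence_exact₂ _
    (LinearMap.shortExact_shortComplexKer hsurj) x hx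
  -- Ext^{D+1}(k, -) = 0 makes Ext^D(k, -) right exact, so a class with values in A₊ lifts to P_1.
  obtain ⟨v, hv⟩ := Ext.covariant_sequence_exact₃ _
    (LinearMap.shortExact_shortComplexKer hp) w rfl
    (Ext.eq_zero_of_hasProjectiveDimensionLT _ (D + 1) le_rfl)
  have hx' : x = v.comp (Ext.mk₀ (ModuleCat.ofHom q)) (add_zero D) := by
    rw [← hw, ← hv, Ext.comp_assoc_of_third_deg_zero, Ext.mk₀_comp_mk₀]
    rfl
  rw [← e.map_eq_zero_iff, hx', ext_to_free_eq_sum v, Ext.sum_comp, map_sum]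
  refine Finset.sum_eq_zero fun s _ => ?_
  -- On each summand of P_1 the map to A is right multiplication by an element of A₊, which acts by
  -- zero on Ext^D(k, A).
  have hmul : (ModuleCat.ofHom (Finsupp.lsingle s) : ModuleCat.of A A ⟶ ModuleCat.of A (r.ι 1 →₀ A)) ≫
      ModuleCat.ofHom q = rightMul (q (Finsupp.single s 1)) := by
    refine ModuleCat.hom_ext (LinearMap.ext_ring ?_)
    change q (Finsupp.single s 1) = (1 : A) • q (Finsupp.single s 1)
    rw [one_smul]
  rw [Ext.comp_assoc_of_third_deg_zero, Ext.mk₀_comp_mk₀, hmul, he]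
  have : ε (q (Finsupp.single s 1)) = 0 := by
    have := hq (Finsupp.single s 1)
    rwa [LinearMap.mem_ker, augHom_apply] at this
  rw [this, mul_zero]

/-- A generator of Ext^D(k, A) has nonzero image in Ext^D(k, k), and a form not vanishing there
makes the pairing for A perfect. The sequences of syzygies then lead to k. -/
theorem isFrobenius_of_isASGorenstein (r : MinimalResolution G) [∀ i, Finite (r.ι i)]
    [Module.Finite k (YonedaAlgebra ε)]
    [HasProjectiveDimensionLT (trivialModule ε) (D + 1)]
    (h : ∀ i : ℕ, i ≠ D → Subsingleton (Ext (trivialModule ε) (ModuleCat.of A A) i))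
    (e : Ext (trivialModule ε) (ModuleCat.of A A) D ≃ₗ[k] k)
    (he : ∀ (x : Ext (trivialModule ε) (ModuleCat.of A A) D) (a : A),
        e (x.comp (Ext.mk₀ (rightMul a)) (add_zero D)) = e x * ε a) :
    IsFrobenius k (YonedaAlgebra ε) := by
  let x₀ := e.symm 1
  have hx₀ : ∀ x, x = e x • x₀ := fun x => by
    apply e.injective
    simp [x₀]
  have hne : x₀.comp (Ext.mk₀ (augHom ε)) (add_zero D) ≠ 0 := fun h0 => by
    have := r.eq_zero_of_comp_augHom_eq_zero e he x₀ h0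
    exact one_ne_zero (α := k) (by rw [← e.apply_symm_apply 1, ← map_zero e]; exact congrArg e this)
  obtain ⟨φ, hφ⟩ : ∃ φ : YonedaExt ε D →ₗ[k] k,
      φ (x₀.comp (Ext.mk₀ (augHom ε)) (add_zero D)) ≠ 0 := by
    by_contra! hall
    exact hne ((Module.forall_dual_apply_eq_zero_iff k _).1 hall)
  have hinj : ∀ i j (hij : i + j = D), PairingInjective φ (ModuleCat.of A A) i j hij := by
    intro i j hij x hx
    by_cases hi : i = D
    · subst hi
      obtain rfl : j = 0 := by lia
      have := hx (Ext.mk₀ (augHom ε))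
      rw [hx₀ x, Ext.smul_comp, map_smul, smul_eq_mul, mul_eq_zero, or_iff_left hφ] at this
      exact e.map_eq_zero_iff.1 this
    · exact (h i hi).elim _ _
  have hsurj : PairingSurjective φ (ModuleCat.of A A) D 0 (add_zero D) := by
    intro ψ
    refine ⟨(ψ (Ext.mk₀ (augHom ε)) / φ (x₀.comp (Ext.mk₀ (augHom ε)) (add_zero D))) • x₀,
      fun y => ?_⟩
    obtain ⟨b, rfl⟩ := ext_zero_eq_smul_aug y
    rw [Ext.smul_comp, Ext.comp_smul, map_smul, map_smul, map_smul, smul_eq_mul, smul_eq_mul,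
      smul_eq_mul]
    field_simp
  refine isFrobenius_of_pairing (D := D)
    (fun i hi x => Ext.eq_zero_of_hasProjectiveDimensionLT x (D + 1) hi) φ ?_
  -- All syzygies are treated at once, since each step raises `l` while it lowers `j`; at j = 0 the
  -- cover P_l → Ω^l suffices.
  suffices key : ∀ j i l (hij : i + j = D), PairingSurjective φ (r.syzygy l) i j hij from
    fun i j hij => key j i 0 hij
  intro j
  induction j with
  | zero =>
    rintro i l rfl
    have : Epi (r.cover l) := (r.shortExact l).epi_g
    exact PairingSurjective.of_epi (r.cover l) _ hsurj.free
  | succ j ih =>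
    intro i l hij
    exact PairingSurjective.of_shortExact (r.shortExact l) hij (by lia)
      (fun y => Ext.eq_zero_of_projective (P := r.term l) y) (ih (i + 1) (l + 1) (by lia))
      (hinj (i + 1) j (by lia)).free

end MinimalResolution

end Gorenstein

/-! ### Pairings for finite-dimensional nilpotent modules -/

section NilpotentModules

variable {k : Type u} [Field k] {A : Type u} [Ring A] [Algebra k A] {ε : A →ₐ[k] k}

/-- M / A₊M is a nonzero vector space on which A acts through `ε`, so any nonzero linear form on it
is A-linear. -/
theorem exists_surjective_trivialModule {M : Type u} [AddCommGroup M] [Module A M]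
    (h : (RingHom.ker ε • ⊤ : Submodule A M) ≠ ⊤) :
    ∃ f : M →ₗ[A] TrivialModule ε, Function.Surjective f := by
  let : Module k M := Module.compHom M (algebraMap k A)
  have : IsScalarTower k A M := IsScalarTower.of_algebraMap_smul fun _ _ => rfl
  let W : Submodule A M := RingHom.ker ε • ⊤
  obtain ⟨m, -, hm⟩ := SetLike.exists_of_lt (lt_top_iff_ne_top.2 h)
  have hm' : (Submodule.Quotient.mk m : M ⧸ W) ≠ 0 := fun h0 =>
    hm ((Submodule.Quotient.mk_eq_zero W).1 h0)
  obtain ⟨g, hg⟩ : ∃ g : Module.Dual k (M ⧸ W), g (Submodule.Quotient.mk m) ≠ 0 := by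
    by_contra! hall
    exact hm' ((Module.forall_dual_apply_eq_zero_iff k _).1 hall)
  let f : M →ₗ[A] TrivialModule ε :=
    { toFun := fun x => (g (Submodule.Quotient.mk x) : k)
      map_add' := fun x y => by rw [Submodule.Quotient.mk_add, map_add]; rfl
      map_smul' := fun a x => by
        have h1 : (Submodule.Quotient.mk (a • x) : M ⧸ W) = ε a • Submodule.Quotient.mk x :=
          (Submodule.Quotient.eq W).2 (ConnectedGrading.smul_sub_aug_smul_mem ⊤ a trivial)
        rw [h1, map_smul]
        rfl }
  refine ⟨f, fun c => ⟨((show k from c) / g (Submodule.Quotient.mk m)) • m, ?_⟩⟩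
  change g (((show k from c) / g (Submodule.Quotient.mk m)) • Submodule.Quotient.mk m) = c
  rw [map_smul, smul_eq_mul, div_mul_cancel₀ _ hg]

namespace ConnectedGrading

variable (G : ConnectedGrading ε)

theorem mul_mem_tail_succ {t : ℤ} {a b : A} (ha : a ∈ G.tail t) (hb : ε b = 0) :
    a * b ∈ G.tail (t + 1) := by
  intro m hm
  obtain ⟨s, hs⟩ := G.exists_sum a
  rw [← hs, Finset.sum_mul, map_sum]
  refine Finset.sum_eq_zero fun l _ => ?_
  rw [G.proj_mul (G.proj_mem l a)]
  rcases lt_or_ge l t with hl | hl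
  · rw [ha l hl, zero_mul]
  · rw [G.proj_nonpos hb (by lia), mul_zero]

theorem mul_mem_tail {t : ℤ} {a : A} (ha : a ∈ G.tail t) (b : A) : a * b ∈ G.tail t := by
  intro m hm
  obtain ⟨s, hs⟩ := G.exists_sum a
  rw [← hs, Finset.sum_mul, map_sum]
  refine Finset.sum_eq_zero fun l _ => ?_
  rw [G.proj_mul (G.proj_mem l a)]
  rcases lt_or_ge l t with hl | hl
  · rw [ha l hl, zero_mul]
  · rw [G.proj_neg (by lia : m - l < 0) b, mul_zero]

/-- If M = A₊M, then A_{≥t}M = A_{≥t}A₊M lies in A_{≥t+1}M. So the annihilation by A_{≥t} descends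
to t = 0, where A_{≥0} contains 1. -/
theorem eq_zero_of_aug_smul_top_eq_top {M : Type u} [AddCommGroup M] [Module A M]
    (h : (RingHom.ker ε • ⊤ : Submodule A M) = ⊤) (t : ℕ)
    (ht : ∀ a ∈ G.tail t, ∀ m : M, a • m = 0) (m : M) : m = 0 := by
  induction t with
  | zero =>
    rw [← one_smul A m]
    exact ht 1 (fun l hl => G.proj_neg hl 1) m
  | succ t ih =>
    refine ih fun a ha m => ?_
    have hm : m ∈ (RingHom.ker ε • ⊤ : Submodule A M) := by rw [h]; trivial
    induction hm using Submodule.smul_induction_on' with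
    | smul b hb z _ =>
      rw [← mul_smul]
      exact ht _ (by push_cast; exact G.mul_mem_tail_succ ha hb) z
    | add x _ y _ hx hy => rw [smul_add, hx, hy, add_zero]

theorem finite_truncation (n : ℤ) : Module.Finite k (A ⧸ G.tail n) := by
  have := G.finite
  let L : A →ₗ[k] (∀ m : Fin n.toNat, G.piece (m : ℕ)) :=
    LinearMap.pi fun m => (G.proj (m : ℕ)).codRestrict _ (G.proj_mem _)
  have hL : LinearMap.ker L = (G.tail n).restrictScalars k := by
    ext a
    constructor
    · intro ha m hm
      rcases lt_or_ge m 0 with h0 | h0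
      · exact G.proj_neg h0 a
      · obtain ⟨m, rfl⟩ := Int.eq_ofNat_of_zero_le h0
        exact congrArg Subtype.val (congrFun ha ⟨m, by lia⟩)
    · intro ha
      refine funext fun m => Subtype.ext (ha _ ?_)
      have := m.2
      lia
  have h1 : Module.Finite k (A ⧸ LinearMap.ker L) :=
    Module.Finite.equiv L.quotKerEquivRange.symm
  rw [hL] at h1
  exact Module.Finite.equiv (Submodule.Quotient.restrictScalarsEquiv k (G.tail n))

end ConnectedGrading

/-- If the Yoneda pairing of the trivial module is perfect, then the Yoneda pairing of every
finite dimensional nilpotent module is nondegenerate on one side. -/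
theorem PairingInjective.of_nilpotent (G : ConnectedGrading ε) {d : ℕ} {φ : YonedaExt ε d →ₗ[k] k}
    (hinj : ∀ i j (h : i + j = d), PairingInjective φ (trivialModule ε) i j h)
    (hsurj : ∀ i j (h : i + j = d), PairingSurjective φ (trivialModule ε) i j h)
    (h0 : ∀ y : YonedaExt ε (d + 1), y = 0) (t : ℕ) (n : ℕ) :
    ∀ (M : Type u) [AddCommGroup M] [Module k M] [Module A M] [IsScalarTower k A M]
      [Module.Finite k M], Module.finrank k M = n → (∀ a ∈ G.tail t, ∀ m : M, a • m = 0) →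
      ∀ i j (h : i + j = d), PairingInjective φ (ModuleCat.of A M) i j h := by
  induction n using Nat.strong_induction_on with
  | _ n ih =>
    intro M _ _ _ _ _ hn ht i j h
    by_cases htop : (RingHom.ker ε • ⊤ : Submodule A M) = ⊤
    · have hM := G.eq_zero_of_aug_smul_top_eq_top htop t ht
      intro x _
      have : 𝟙 (ModuleCat.of A M) = 0 := by
        ext m
        exact (hM _).trans (hM _).symm
      rw [← Ext.comp_mk₀_id x, this, Ext.mk₀_zero, Ext.comp_zero]
    -- Dévissage: `M` is an extension of k by a nilpotent module of smaller dimension.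
    · obtain ⟨f, hf⟩ := exists_surjective_trivialModule htop
      have hker : ((LinearMap.ker f).restrictScalars k) < ⊤ := by
        rw [lt_top_iff_ne_top]
        intro h1
        obtain ⟨m, hm⟩ := hf (TrivialModule.one ε)
        have h2 : m ∈ (LinearMap.ker f).restrictScalars k := h1 ▸ trivial
        have h3 : f m = 0 := h2
        rw [hm] at h3
        exact one_ne_zero (α := k) h3
      have hfin : Module.Finite k (LinearMap.ker f) :=
        inferInstanceAs (Module.Finite k ((LinearMap.ker f).restrictScalars k))
      refine PairingInjective.of_shortExact (LinearMap.shortExact_shortComplexKer hf) h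
        (ih _ ?_ (LinearMap.ker f) rfl (fun a ha m => Subtype.ext (ht a ha m)) i j h)
        (hinj i j h) (fun i' hi => hsurj i' (j + 1) (by lia)) ?_
      · rw [← hn]
        exact Submodule.finrank_lt hker.ne
      · rintro rfl y
        obtain rfl : j = d := by lia
        exact h0 y

end NilpotentModules

/-! ### Frobenius implies AS-Gorenstein -/

section FrobeniusToGorenstein

variable {k : Type u} [Field k] {A : Type u} [Ring A] [Algebra k A] {ε : A →ₐ[k] k}

theorem exists_eq_smul_one (x : YonedaExt ε 0) :
    ∃ b : k, x = b • Ext.mk₀ (𝟙 (trivialModule ε)) := by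
  obtain ⟨f, rfl⟩ := Ext.addEquiv₀.symm.surjective x
  obtain ⟨b, hb⟩ : ∃ b : k, @Eq k (f.hom (TrivialModule.one ε)) b := ⟨_, rfl⟩
  refine ⟨b, ?_⟩
  rw [Ext.addEquiv₀_symm_apply, ← Ext.mk₀_smul]
  congr 1
  ext c
  obtain ⟨c', hc'⟩ : ∃ c' : k, @Eq k c c' := ⟨_, rfl⟩
  have hc : c = algebraMap k A c' • TrivialModule.one ε := by
    rw [TrivialModule.smul_one, AlgHom.commutes]
    exact hc'
  rw [hc, map_smul, map_smul]
  congr 1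
  change f.hom (TrivialModule.one ε) = algebraMap k A b • TrivialModule.one ε
  rw [TrivialModule.smul_one, AlgHom.commutes]
  exact hb

theorem one_yonedaExt_ne_zero : (Ext.mk₀ (𝟙 (trivialModule ε)) : YonedaExt ε 0) ≠ 0 := by
  rw [Ne, Ext.mk₀_eq_zero_iff]
  intro h
  have : TrivialModule.one ε = 0 := congrArg (fun q => q.hom (TrivialModule.one ε)) h
  exact one_ne_zero (α := k) this

theorem of_smul_one_mul {m : ℕ} (b : k) (u : YonedaExt ε m) :
    DirectSum.of (YonedaExt ε) 0 (b • Ext.mk₀ (𝟙 (trivialModule ε))) *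
      DirectSum.of (YonedaExt ε) m u = b • DirectSum.of (YonedaExt ε) m u := by
  rw [yoneda_of_mul_of u _ (add_zero m), Ext.comp_smul, Ext.comp_mk₀_id]
  exact (DirectSum.lof k ℕ (YonedaExt ε) m).map_smul b u

/-- A linear form on the Yoneda algebra which is nondegenerate has proportional values on elements
of the right socle. -/
theorem functional_smul_of_eq {lam : YonedaAlgebra ε →ₗ[k] k}
    (hlam : ∀ a, (∀ c, lam (c * a) = 0) → a = 0) {m n : ℕ} (u : YonedaExt ε m)
    (t : YonedaExt ε n) (hu : ∀ j, 0 < j → ∀ g : YonedaExt ε j, Ext.comp u g rfl = 0)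
    (ht : ∀ j, 0 < j → ∀ g : YonedaExt ε j, Ext.comp t g rfl = 0) :
    lam (DirectSum.of (YonedaExt ε) n t) • DirectSum.of (YonedaExt ε) m u =
      lam (DirectSum.of (YonedaExt ε) m u) • DirectSum.of (YonedaExt ε) n t := by
  rw [← sub_eq_zero]
  refine hlam _ fun c => ?_
  rw [mul_sub, mul_smul_comm, mul_smul_comm, map_sub, map_smul, map_smul, sub_eq_zero]
  induction c using DirectSum.induction_on with
  | zero => simp only [zero_mul, map_zero, smul_zero]
  | add x y hx hy => rw [add_mul, add_mul, map_add, map_add, smul_add, smul_add, hx, hy]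
  | of j g =>
    rcases Nat.eq_zero_or_pos j with rfl | hj
    · obtain ⟨b, rfl⟩ := exists_eq_smul_one g
      rw [of_smul_one_mul, of_smul_one_mul, map_smul, map_smul, smul_eq_mul, smul_eq_mul,
        smul_eq_mul, smul_eq_mul]
      ring
    · rw [yoneda_of_mul_of u g rfl, yoneda_of_mul_of t g rfl, hu j hj, ht j hj]
      simp only [map_zero, smul_zero]

/-- If E₊z = 0 then Ez is the line kz, on which a nondegenerate form cannot vanish unless z = 0. -/
theorem eq_zero_of_functional_of_eq_zero {lam : YonedaAlgebra ε →ₗ[k] k}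
    (hlam : ∀ a, (∀ c, lam (c * a) = 0) → a = 0) {d : ℕ} (z : YonedaExt ε d)
    (hz : ∀ j, 0 < j → ∀ g : YonedaExt ε j, Ext.comp z g rfl = 0)
    (h : lam (DirectSum.of (YonedaExt ε) d z) = 0) : z = 0 := by
  refine (map_eq_zero_iff _ (DirectSum.of_injective (β := YonedaExt ε) d)).1 (hlam _ fun c => ?_)
  induction c using DirectSum.induction_on with
  | zero => rw [zero_mul, map_zero]
  | add x y hx hy => rw [add_mul, map_add, hx, hy, add_zero]
  | of j g =>
    rcases Nat.eq_zero_or_pos j with rfl | hj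
    · obtain ⟨b, rfl⟩ := exists_eq_smul_one g
      rw [of_smul_one_mul, map_smul, h, smul_zero]
    · rw [yoneda_of_mul_of z g rfl, hz j hj, map_zero, map_zero]

/-- Take `g` of the largest possible degree with nonzero product; degrees are bounded by `d`. Thus
every nonzero homogeneous element has a left multiple which is nonzero and killed by E₊. -/
theorem exists_comp_ne_zero_maximal {d i : ℕ} (hd : ∀ i, d < i → ∀ x : YonedaExt ε i, x = 0)
    (f : YonedaExt ε i) (hf : f ≠ 0) :
    ∃ (m : ℕ) (g : YonedaExt ε m), Ext.comp f g rfl ≠ 0 ∧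
      ∀ l, 0 < l → ∀ g' : YonedaExt ε l, Ext.comp (Ext.comp f g rfl) g' rfl = 0 := by
  classical
  let P : ℕ → Prop := fun m => ∃ g : YonedaExt ε m, Ext.comp f g rfl ≠ 0
  have hP0 : P 0 := ⟨Ext.mk₀ (𝟙 _), by rwa [Ext.comp_mk₀_id]⟩
  obtain ⟨m, ⟨g, hg⟩, hmax⟩ : ∃ m, P m ∧ ∀ m', m < m' → m' ≤ d → ¬ P m' :=
    ⟨_, Nat.findGreatest_spec (Nat.zero_le d) hP0,
      fun _ h1 h2 => Nat.findGreatest_is_greatest h1 h2⟩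
  refine ⟨m, g, hg, fun l hl g' => ?_⟩
  rcases lt_or_ge d (i + m + l) with hlt | hle
  · exact hd _ hlt _
  · have h1 : Ext.comp f (Ext.comp g g' rfl) rfl = 0 := by
      by_contra hne
      exact hmax (m + l) (by lia) (by lia) ⟨_, hne⟩
    rw [Ext.comp_assoc f g g' rfl rfl (by lia)]
    have h2 := YonedaExt.mk_comp_eq f (Ext.comp g g' rfl) (rfl : i + (m + l) = _)
      (by lia : i + (m + l) = i + m + l)
    rw [h1] at h2
    have h3 := DirectSum.of_eq_of_gradedMonoid_eq h2
    rw [map_zero, eq_comm] at h3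
    exact (map_eq_zero_iff _ (DirectSum.of_injective (β := YonedaExt ε) _)).1 h3

/-- Injectivity in degrees (i, j) and (j, i) forces the two dimensions to agree. -/
theorem PairingSurjective.of_injective {d : ℕ} {φ : YonedaExt ε d →ₗ[k] k}
    (hfin : ∀ i, Module.Finite k (YonedaExt ε i))
    (hinj : ∀ i j (h : i + j = d), PairingInjective φ (trivialModule ε) i j h)
    (i j : ℕ) (h : i + j = d) : PairingSurjective φ (trivialModule ε) i j h := by
  let β : ∀ i j (h : i + j = d), YonedaExt ε i →ₗ[k] Module.Dual k (YonedaExt ε j) := fun i j h =>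
    { toFun := fun x => φ ∘ₗ extPrecomp k x (trivialModule ε) h
      map_add' := fun x y => by
        ext z
        change φ ((x + y).comp z h) = φ (x.comp z h) + φ (y.comp z h)
        rw [Ext.add_comp, map_add]
      map_smul' := fun c x => by
        ext z
        change φ ((c • x).comp z h) = c • φ (x.comp z h)
        rw [Ext.smul_comp, map_smul] }
  have hβ : ∀ i j h, Function.Injective (β i j h) := by
    intro i j h
    rw [injective_iff_map_eq_zero]
    intro x hx
    exact hinj i j h x fun y => LinearMap.congr_fun hx y
  have hle : ∀ i j (h : i + j = d), Module.finrank k (YonedaExt ε i) ≤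
      Module.finrank k (YonedaExt ε j) := fun i j h => by
    have := LinearMap.finrank_le_finrank_of_injective (hβ i j h)
    rwa [Subspace.dual_finrank_eq] at this
  have hs : Function.Surjective (β i j h) := by
    refine (LinearMap.injective_iff_surjective_of_finrank_eq_finrank ?_).1 (hβ i j h)
    rw [Subspace.dual_finrank_eq]
    exact le_antisymm (hle i j h) (hle j i (by lia))
  intro ψ
  obtain ⟨x, hx⟩ := hs ψ
  exact ⟨x, fun y => LinearMap.congr_fun hx y⟩

/-- The top degree component of a Frobenius Yoneda algebra is its socle, hence the Yoneda products
into the top degree are nondegenerate. -/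
theorem pairingInjective_of_functional {lam : YonedaAlgebra ε →ₗ[k] k}
    (hlam : ∀ a, (∀ c, lam (c * a) = 0) → a = 0) {d : ℕ} {t : YonedaExt ε d} (ht : t ≠ 0)
    (hd : ∀ i, d < i → ∀ x : YonedaExt ε i, x = 0) (i j : ℕ) (h : i + j = d) :
    PairingInjective (lam ∘ₗ DirectSum.lof k ℕ (YonedaExt ε) d) (trivialModule ε) i j h := by
  have htop : ∀ (t : YonedaExt ε d), ∀ j, 0 < j → ∀ g : YonedaExt ε j, Ext.comp t g rfl = 0 :=
    fun t j hj g => hd _ (by lia) _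
  intro f hf
  by_contra hf0
  obtain ⟨m, g, hg, hkill⟩ := exists_comp_ne_zero_maximal hd f hf0
  -- Both `f` followed by `g` and the top class `t` are killed by E₊, so they are proportional;
  -- hence their degrees agree and `g` has degree `j`.
  have hst := functional_smul_of_eq hlam (Ext.comp f g rfl) t hkill (htop t)
  have hlt : lam (DirectSum.of (YonedaExt ε) d t) ≠ 0 := fun h0 =>
    ht (eq_zero_of_functional_of_eq_zero hlam t (htop t) h0)
  have him : d = i + m := by
    by_contra hne
    have := congrArg (fun w => w (i + m)) hst
    change lam (DirectSum.of (YonedaExt ε) d t) • (DirectSum.of (YonedaExt ε) (i + m) _) (i + m) =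
      lam _ • (DirectSum.of (YonedaExt ε) d t) (i + m) at this
    rw [DirectSum.of_eq_same, DirectSum.of_eq_of_ne _ _ _ (Ne.symm hne), smul_zero] at this
    exact hg ((smul_eq_zero.1 this).resolve_left hlt)
  subst him
  obtain rfl : j = m := by lia
  exact hg (eq_zero_of_functional_of_eq_zero hlam _ hkill (hf g))

/-- The image of 1 under E ≅ E* is a nondegenerate form; `φ` is its restriction to the largest
degree `d` in which E is nonzero. That `d` is the global dimension is proved only in
`MinimalResolution.isASGorenstein_of_pairing`. -/
theorem exists_pairing_of_isFrobenius (hE : IsFrobenius k (YonedaAlgebra ε)) {D : ℕ}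
    (hfin : ∀ i, Module.Finite k (YonedaExt ε i)) (hD : ∀ i, D < i → ∀ x : YonedaExt ε i, x = 0) :
    ∃ (d : ℕ) (φ : YonedaExt ε d →ₗ[k] k), (∀ z, φ z = 0 → z = 0) ∧ (∃ z : YonedaExt ε d, z ≠ 0) ∧
      (∀ i, d < i → ∀ x : YonedaExt ε i, x = 0) ∧
      (∀ i j (h : i + j = d), PairingInjective φ (trivialModule ε) i j h) ∧
      (∀ i j (h : i + j = d), PairingSurjective φ (trivialModule ε) i j h) := by
  classical
  obtain ⟨-, e, he⟩ := hE
  have hlam : ∀ a, (∀ c, e 1 (c * a) = 0) → a = 0 := fun a ha => by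
    rw [← e.map_eq_zero_iff]
    refine LinearMap.ext fun c => ?_
    have := he a 1 c
    rw [mul_one, ha] at this
    exact this
  let p : ℕ → Prop := fun i => ∃ x : YonedaExt ε i, x ≠ 0
  have hp0 : p 0 := ⟨_, one_yonedaExt_ne_zero⟩
  obtain ⟨d, ⟨t, ht⟩, hmax⟩ : ∃ d, p d ∧ ∀ i, d < i → i ≤ D → ¬ p i :=
    ⟨_, Nat.findGreatest_spec (Nat.zero_le D) hp0,
      fun _ h1 h2 => Nat.findGreatest_is_greatest h1 h2⟩
  have hd : ∀ i, d < i → ∀ x : YonedaExt ε i, x = 0 := fun i hi x => by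
    rcases le_or_gt i D with hiD | hiD
    · by_contra hx
      exact hmax i hi hiD ⟨x, hx⟩
    · exact hD i hiD x
  have hinj := pairingInjective_of_functional hlam ht hd
  exact ⟨d, _, fun z hz => eq_zero_of_functional_of_eq_zero hlam z
    (fun j hj g => hd _ (by lia) _) hz, ⟨t, ht⟩, hd, hinj,
    PairingSurjective.of_injective hfin hinj⟩

namespace MinimalResolution

variable {G : ConnectedGrading ε}

/-- Injectivity for the nilpotent modules A/A_{≥n} passes to A in the limit. The vanishing of
Ext^{d+1}(k, k) ends the minimal resolution at step d and so bounds all projective dimensions. -/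
theorem isASGorenstein_of_pairing (r : MinimalResolution G) [∀ i, Finite (r.ι i)] {d : ℕ}
    (φ : YonedaExt ε d →ₗ[k] k) (hφ : ∀ z, φ z = 0 → z = 0) (hd : ∃ z : YonedaExt ε d, z ≠ 0)
    (hd' : ∀ i, d < i → ∀ x : YonedaExt ε i, x = 0)
    (hinj : ∀ i j (h : i + j = d), PairingInjective φ (trivialModule ε) i j h)
    (hsurj : ∀ i j (h : i + j = d), PairingSurjective φ (trivialModule ε) i j h) :
    IsASGorenstein ε := by
  have hpd : ∀ M : ModuleCat.{u} A, HasProjectiveDimensionLT M (d + 1) :=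
    r.hasProjectiveDimensionLT (r.isEmpty_of_ext_eq_zero (hd' _ (by lia)))
  obtain ⟨z, hz⟩ := hd
  -- The condition on `x` is void for i < d, so this gives both the vanishing below degree `d` and
  -- the injectivity of Ext^d(k, A) → k.
  have key : ∀ i j, i + j = d → ∀ x : Ext (trivialModule ε) (ModuleCat.of A A) i,
      (∀ h : i + 0 = d, φ (x.comp (Ext.mk₀ (augHom ε)) h) = 0) → x = 0 := by
    intro i j h x hx
    refine r.ext_eq_zero_of_truncation (l := 0) x fun n => ?_
    have := G.finite_truncation n
    refine PairingInjective.of_nilpotent G hinj hsurj (hd' _ (by lia)) n.toNat _ (A ⧸ G.tail n) rfl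
      ?_ i j h _ fun y => ?_
    · intro a ha m
      obtain ⟨b, rfl⟩ := Submodule.Quotient.mk_surjective _ m
      refine (Submodule.Quotient.mk_eq_zero _).2 (G.mul_mem_tail (fun l hl => ha l ?_) b)
      lia
    · refine (congrArg φ (Ext.comp_assoc_of_second_deg_zero (X := trivialModule ε) x
        (Ext.mk₀ (G.truncation n)) y h)).trans ?_
      -- Restricted to A, the class `y` is a multiple of the augmentation if j = 0, and zero if j >
      -- 0 since A is projective.
      cases j with
      | zero =>
        obtain ⟨b, hb⟩ := ext_zero_eq_smul_aug
          ((Ext.mk₀ (G.truncation n)).comp y (zero_add 0))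
        rw [hb, Ext.comp_smul, map_smul, hx h, smul_zero]
      | succ j =>
        rw [Ext.eq_zero_of_projective ((Ext.mk₀ (G.truncation n)).comp y (zero_add (j + 1))),
          Ext.comp_zero, map_zero]
  let E : Ext (trivialModule ε) (ModuleCat.of A A) d →ₗ[k] k :=
    φ ∘ₗ extPostcomp k (trivialModule ε) (Ext.mk₀ (augHom ε)) (add_zero d)
  have hEi : Function.Injective E := by
    rw [injective_iff_map_eq_zero]
    exact fun x hx => key d 0 rfl x fun _ => hx
  -- Ext^{d+1}(k, A₊) = 0, so a nonzero class of Ext^d(k, k) lifts to Ext^d(k, A).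
  have hEs : Function.Surjective E := by
    have hsurj : Function.Surjective (augHom ε).hom := fun c =>
      ⟨algebraMap k A c, by rw [augHom_apply]; exact ε.commutes c⟩
    have := hpd (trivialModule ε)
    obtain ⟨x, hx⟩ := Ext.covariant_sequence_exact₃ _
      (LinearMap.shortExact_shortComplexKer hsurj) z rfl
      (Ext.eq_zero_of_hasProjectiveDimensionLT _ (d + 1) le_rfl)
    have hEx : E x ≠ 0 := fun h0 => hz (hφ z (by rw [← hx]; exact h0))
    exact fun c => ⟨(c / E x) • x, by rw [map_smul, smul_eq_mul, div_mul_cancel₀ _ hEx]⟩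
  refine ⟨d, le_antisymm ?_ ?_, fun i hi => ?_, LinearEquiv.ofBijective E ⟨hEi, hEs⟩,
    fun x a => ?_⟩
  · exact iSup_le fun M => (projectiveDimension_le_iff M d).2 (hpd M)
  -- The trivial module attains the bound, since Ext^d(k, k) is nonzero.
  · refine le_trans ?_ (le_iSup _ (trivialModule ε))
    rw [projectiveDimension_ge_iff]
    intro h
    exact hz (Ext.eq_zero_of_hasProjectiveDimensionLT z d le_rfl)
  · rcases lt_or_gt_of_ne hi with h | h
    · obtain ⟨j, rfl⟩ := Nat.exists_eq_add_of_lt h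
      exact subsingleton_of_forall_eq 0 fun x => key i (j + 1) rfl x fun h => by lia
    · have := hpd (trivialModule ε)
      exact subsingleton_of_forall_eq 0 fun x =>
        Ext.eq_zero_of_hasProjectiveDimensionLT x (d + 1) h
  -- Right multiplication by `a` followed by the augmentation is `ε a` times the augmentation.
  · change φ ((x.comp (Ext.mk₀ (rightMul a)) (add_zero d)).comp (Ext.mk₀ (augHom ε))
      (add_zero d)) = φ (x.comp (Ext.mk₀ (augHom ε)) (add_zero d)) * ε a
    rw [Ext.comp_assoc_of_third_deg_zero, Ext.mk₀_comp_mk₀, rightMul_comp_augHom, Ext.mk₀_smul,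
      Ext.comp_smul, map_smul, smul_eq_mul, mul_comm]

end MinimalResolution

end FrobeniusToGorenstein

/-! ### The equivalence for Koszul homogeneous algebras -/

theorem corollary5p12 {k : Type u} [Field k] {V : Type u} [AddCommGroup V] [Module k V]
    [Module.Finite k V] (N : ℕ) [N.AtLeastTwo] (R : Submodule k (⨂[k]^N V))
    (hK : HomogeneousAlgebra.IsKoszul R)
    (D : ℕ) (hD : globalDimension (HomogeneousAlgebra R) = D) :
    Module.Finite k (YonedaAlgebra (HomogeneousAlgebra.augmentation R)) ∧
      (IsASGorenstein (HomogeneousAlgebra.augmentation R) ↔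
        IsFrobenius k (YonedaAlgebra (HomogeneousAlgebra.augmentation R))) := by
  obtain ⟨r, hr⟩ := hK.exists_finite_minimalResolution
  have hpd : ∀ d : ℕ, globalDimension (HomogeneousAlgebra R) = d →
      HasProjectiveDimensionLT (trivialModule (HomogeneousAlgebra.augmentation R)) (d + 1) :=
    fun d hd => (projectiveDimension_le_iff _ d).1 (hd ▸ le_iSup _ _)
  have hfin : ∀ i, Module.Finite k (YonedaExt (HomogeneousAlgebra.augmentation R) i) :=
    fun i => r.finite_ext i 0
  have h0 : ∀ i, D < i → ∀ x : YonedaExt (HomogeneousAlgebra.augmentation R) i, x = 0 := by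
    have := hpd D hD
    exact fun i hi x => Ext.eq_zero_of_hasProjectiveDimensionLT x (D + 1) hi
  have hE := finite_yonedaAlgebra hfin h0
  refine ⟨hE, ?_, fun hF => ?_⟩
  · rintro ⟨d, hd, h, e, he⟩
    have := hpd d hd
    exact r.isFrobenius_of_isASGorenstein h e he
  · obtain ⟨d, φ, hφ, hd, hd', hinj, hsurj⟩ := exists_pairing_of_isFrobenius hF hfin h0
    exact r.isASGorenstein_of_pairing φ hφ hd hd' hinj hsurj
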